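/- **Theorem (Thermodynamic limits for the annealed $\mathrm{CM}_N(\mathbf 1,\mathbf 2)$).** *Setting.* Fix $p\in(0,1)$. For each $N$ let $d_1,\dots,d_N\in\{1,2\}$ be degrees of which exactly $\lfloor pN\rfloor$ equal $2$ and $N-\lfloor pN\rfloor$ equal $1$. For those $N$ for which the total degree $N+\lfloor pN\rfloor$ is even, let $G_N$ be the configuration model with these degrees: attach $d_i$ half-edges to vertex $i$ and pair all half-edges uniformly at random (self-loops and multiple edges are allowed); $Q_N$ denotes expectation over $G_N$. All limits $N\to\infty$ are along these $N$. For $\sigma\in\{-1,1\}^N$ let $S_N=\sum_i\sigma_i$ and let $W_N(\sigma)=\exp\big[\beta\sum_{(i,j)\in E_N}\sigma_i\sigma_j+BS_N\big]$, the sum running over edges with multiplicity, and let $Z_N=\sum_\sigma W_N(\sigma)$. The annealed measure, pressure and magnetization are $$\widetilde P_N(\sigma)=\frac{Q_N(W_N(\sigma))}{Q_N(Z_N)},\qquad \widetilde\psi_N(\beta,B)=\frac1N\log Q_N(Z_N),\qquad \widetilde M_N(\beta,B)=\sum_\sigma\widetilde P_N(\sigma)\frac{S_N}{N}.$$ *Explicit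 functions.* For $\beta>0$, $B\in\mathbb R$ put $$\lambda_\pm=e^{\beta}\Big[\cosh B\pm\sqrt{\sinh^2B+e^{-4\beta}}\Big],\qquad A_\pm=\frac{e^{-2\beta}e^{\pm B}+(\lambda_+-e^{\beta+B})^2e^{\mp B}\pm2e^{-\beta}(\lambda_+-e^{\beta+B})}{[e^{-2\beta}+(\lambda_+-e^{\beta+B})^2]\,\lambda_\pm},$$ $r=\lambda_- /\lambda_+$, $a=A_- /A_+$, and on $D_p=[0,\frac{1-p}2]\times[0,p]$ let $$\begin{aligned}H(s,t)={}&(1-p)\log\tfrac{1-p}2-2s\log s-2\big(\tfrac{1-p}2-s\big)\log\big(\tfrac{1-p}2-s\big)+s\log(ar^2)+t\log r\\&+(s+t)\log(s+t)-t\log t+\big(\tfrac{1+p}2-s-t\big)\log\big(\tfrac{1+p}2-s-t\big)\\&-(p-t)\log(p-t)-\tfrac{1+p}2\log\tfrac{1+p}2+p\log p,\end{aligned}$$ with $0\log0=0$. One has $a>0$ if $B\ne0$ and $a=0$ if $B=0$; in the latter case $s\log(ar^2)$ is read as $-\infty$ for $s>0$ and as $0$ for $s=0$. *Statement.* For all $\beta>0$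 and $B\in\mathbb R$: (i) $H$ has a unique maximum point $(s^*,t^*)=(s^*,t^*)(\beta,B)$ on $D_p$. If $B\neq0$, then $H$ is strictly concave on $D_p$ and $(s^*,t^*)$ lies in the interior of $D_p$; if $B=0$, then $(s^*,t^*)=(0,0)$. The annealed pressure converges: $$\widetilde\psi(\beta,B):=\lim_{N\to\infty}\widetilde\psi_N(\beta,B)=\log\lambda_+(\beta,B)+\frac{1-p}2\log A_+(\beta,B)+H(s^*,t^*).$$ (ii) $\widetilde\psi(\beta,\cdot)$ is differentiable at $B$, and the annealed magnetization converges: $$\widetilde M(\beta,B):=\lim_{N\to\infty}\widetilde M_N(\beta,B)=\frac{\partial}{\partial B}\widetilde\psi(\beta,B),$$ and it equals $$\frac{\partial}{\partial B}\log\lambda_++\frac{1-p}2\frac{\partial}{\partial B}\log A_++s^*\frac{\partial}{\partial B}\log(ar^2)+t^*\frac{\partial}{\partial B}\log r,$$ where all the derivatives exist, except that for $B=0$ the third term is read as $0$ (there $s^*=0$). (iii) $\lim_{B\to0^+}\widetilde M(\beta,B)=0$ for every $\beta>0$. Consequently $\beta_c:=\inf\{\beta>0:\lim_{B\to0^+}\widetilde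 M(\beta,B)>0\}=\inf\emptyset=\infty$, that is, there is no annealed phase transition. -/

import Mathlib

open Filter Topology

namespace AnnealedIsing

noncomputable section

/-! ## The configuration model -/

/-- The half-edges of a degree sequence `d`: vertex `i` carries `d i` of them. -/
abbrev HalfEdge {N : ℕ} (d : Fin N → ℕ) : Type := Σ i : Fin N, Fin (d i)

/-- The pairings of the half-edges (fixed-point-free involutions). A pairing is a realisation of the
configuration model: every pair `{h, π h}` is an edge between the vertices `h.1` and `(π h).1`,
self-loops and multiple edges being allowed. -/
abbrev Pairing {N : ℕ} (d : Fin N → ℕ) : Type :=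
  {π : Equiv.Perm (HalfEdge d) // ∀ h, π (π h) = h ∧ π h ≠ h}

/-- Expectation with respect to the configuration model with degrees `d`, that is, with respect to a
uniformly random pairing of the half-edges. -/
def cmExpect {N : ℕ} (d : Fin N → ℕ) (X : Pairing d → ℝ) : ℝ :=
  (∑ π : Pairing d, X π) / (Fintype.card (Pairing d) : ℝ)

/-- `d` is a degree sequence of `CM_N(1,2)` with parameter `p`: all degrees are `1` or `2`, and exactly
`⌊pN⌋` vertices have degree `2` (so `N - ⌊pN⌋` have degree `1`). -/
def IsOneTwoDegrees (p : ℝ) {N : ℕ} (d : Fin N → ℕ) : Prop :=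
  (∀ i, d i = 1 ∨ d i = 2) ∧ (Finset.univ.filter fun i => d i = 2).card = ⌊p * (N : ℝ)⌋₊

/-- `N → ∞` along those sizes for which the total degree is even, i.e. for which the configuration
model with degrees `d N` exists. -/
def evenSizes (d : (N : ℕ) → Fin N → ℕ) : Filter ℕ :=
  atTop ⊓ 𝓟 {N | Even (∑ i, d N i)}

/-! ## The annealed Ising model -/

/-- The real value `±1` of the spin at vertex `i`; spin configurations are maps to `ℤˣ = {1, -1}`. -/
def spin {N : ℕ} (σ : Fin N → ℤˣ) (i : Fin N) : ℝ := ((σ i : ℤ) : ℝ)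

/-- The total spin `S_N`. -/
def totalSpin {N : ℕ} (σ : Fin N → ℤˣ) : ℝ := ∑ i, spin σ i

/-- The sum of `σ_i σ_j` over all edges `(i,j)` of the multigraph, with multiplicity. Every edge has two
half-edges (also when it is a self-loop), which explains the factor `1 / 2`. -/
def edgeSum {N : ℕ} {d : Fin N → ℕ} (π : Pairing d) (σ : Fin N → ℤˣ) : ℝ :=
  (1 / 2) * ∑ h : HalfEdge d, spin σ h.1 * spin σ (π.1 h).1

/-- The Boltzmann weight of `σ` on a given multigraph. -/
def boltzmannWeight {N : ℕ} {d : Fin N → ℕ} (β B : ℝ) (π : Pairing d) (σ : Fin N → ℤˣ) : ℝ :=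
  Real.exp (β * edgeSum π σ + B * totalSpin σ)

/-- The partition function `Z_N(β, B)` of a given multigraph. -/
def partitionFunction {N : ℕ} {d : Fin N → ℕ} (β B : ℝ) (π : Pairing d) : ℝ :=
  ∑ σ : Fin N → ℤˣ, boltzmannWeight β B π σ

/-- The annealed measure: numerator and denominator of the Gibbs measure are averaged separately. -/
def annealedMeasure {N : ℕ} (d : Fin N → ℕ) (β B : ℝ) (σ : Fin N → ℤˣ) : ℝ :=
  cmExpect d (fun π => boltzmannWeight β B π σ) / cmExpect d (partitionFunction β B)

/-- The annealed pressure `(1/N) log Q_N(Z_N(β, B))`. -/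
def annealedPressure {N : ℕ} (d : Fin N → ℕ) (β B : ℝ) : ℝ :=
  (1 / (N : ℝ)) * Real.log (cmExpect d (partitionFunction β B))

/-- The annealed magnetization, the mean of `S_N / N` under the annealed measure. -/
def annealedMagnetization {N : ℕ} (d : Fin N → ℕ) (β B : ℝ) : ℝ :=
  ∑ σ : Fin N → ℤˣ, annealedMeasure d β B σ * (totalSpin σ / (N : ℝ))

/-- The critical inverse temperature `inf {β > 0 : M(β, 0⁺) > 0}` of a limiting magnetization `M`, where
`M(β, 0⁺) = lim_{B → 0⁺} M(β, B)`; it is `⊤` when the set is empty. -/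
def criticalInverseTemperature (M : ℝ → ℝ → ℝ) : EReal :=
  sInf ((fun β : ℝ => (β : EReal)) ''
    {β : ℝ | 0 < β ∧ ∃ m : ℝ, 0 < m ∧ Tendsto (M β) (𝓝[>] 0) (𝓝 m)})

/-! ## The explicit functions -/

/-- `λ₊(β, B)` -/
def lamPlus (β B : ℝ) : ℝ :=
  Real.exp β * (Real.cosh B + Real.sqrt (Real.sinh B ^ 2 + Real.exp (-4 * β)))

/-- `λ₋(β, B)` -/
def lamMinus (β B : ℝ) : ℝ :=
  Real.exp β * (Real.cosh B - Real.sqrt (Real.sinh B ^ 2 + Real.exp (-4 * β)))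

/-- `A₊(β, B)` -/
def APlus (β B : ℝ) : ℝ :=
  (Real.exp (-2 * β) * Real.exp B + (lamPlus β B - Real.exp (β + B)) ^ 2 * Real.exp (-B)
      + 2 * Real.exp (-β) * (lamPlus β B - Real.exp (β + B)))
    / ((Real.exp (-2 * β) + (lamPlus β B - Real.exp (β + B)) ^ 2) * lamPlus β B)

/-- `A₋(β, B)` -/
def AMinus (β B : ℝ) : ℝ :=
  (Real.exp (-2 * β) * Real.exp (-B) + (lamPlus β B - Real.exp (β + B)) ^ 2 * Real.exp B
      - 2 * Real.exp (-β) * (lamPlus β B - Real.exp (β + B)))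
    / ((Real.exp (-2 * β) + (lamPlus β B - Real.exp (β + B)) ^ 2) * lamMinus β B)

/-- `a(β, B) = A₋ / A₊`. It is positive for `B ≠ 0`, and zero for `B = 0`. -/
def aRatio (β B : ℝ) : ℝ := AMinus β B / APlus β B

/-- `r(β, B) = λ₋ / λ₊` -/
def rRatio (β B : ℝ) : ℝ := lamMinus β B / lamPlus β B

/-- The rectangle `D_p = [0, (1-p)/2] × [0, p]`. -/
def rect (p : ℝ) : Set (ℝ × ℝ) := Set.Icc 0 ((1 - p) / 2) ×ˢ Set.Icc 0 p

/-- The function `H(s, t)`, `z = (s, t)`, by its formula. On the boundary of the rectangle `0 log 0 = 0`,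
which is the continuous extension. -/
def H (p β B : ℝ) (z : ℝ × ℝ) : ℝ :=
  (1 - p) * Real.log ((1 - p) / 2) - 2 * z.1 * Real.log z.1
    - 2 * ((1 - p) / 2 - z.1) * Real.log ((1 - p) / 2 - z.1)
    + z.1 * Real.log (aRatio β B * rRatio β B ^ 2) + z.2 * Real.log (rRatio β B)
    + (z.1 + z.2) * Real.log (z.1 + z.2) - z.2 * Real.log z.2
    + ((1 + p) / 2 - z.1 - z.2) * Real.log ((1 + p) / 2 - z.1 - z.2)
    - (p - z.2) * Real.log (p - z.2)
    - (1 + p) / 2 * Real.log ((1 + p) / 2) + p * Real.log p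

/-- `H` with its value `-∞` where the term `s log (a r²)` is `-∞`, that is, for `a = 0` and `s > 0`.
As `a > 0` for `B ≠ 0`, this differs from `H` only at `B = 0`. -/
def HExt (p β B : ℝ) (z : ℝ × ℝ) : EReal :=
  open Classical in if aRatio β B = 0 ∧ 0 < z.1 then ⊥ else (H p β B z : EReal)

end

end AnnealedIsing

namespace AnnealedIsing

open Real (negMulLog)

/-! ### Perfect matchings of a finite set -/

/-! The edge weight $e^{\beta\sigma\tau}$ is written as a sum over two colours, $\sum_b
f_b(\sigma)f_b(\tau)$, with $f_\pm$ built from the eigenvectors of the transfer matrix of the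
one-dimensional Ising model (`exists_colour_factors`). By orthogonality, summing out the spin at a
vertex of degree two leaves a nonzero factor only if its two half-edges have the same colour. Hence
$Q_N(Z_N)$ is a sum over vertex colourings of a product of vertex factors times the probability that
a uniform matching preserves the colouring (`cmExpect_partitionFunction`). The couplings of the
random graph survive only in this probability.

With $2m$ half-edges, $2l$ of them of the second colour, the probability is $1/\binom ml$ up to
polynomial factors, and $1/\binom ml$ is, again up to such factors, the maximum of
$x^{2(m-l)}y^{2l}$ over $x^2+y^2=1$ divided into nothing else. For fixed $(x,y)$ the sum over
colourings factorises, so the pressure is $\log\lambda_++\frac{1-p}2\log A_+$ plus the maximum of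
$(1-p)\log(x+vy)+p\log(x^2+ry^2)$ on a quarter circle, with $v^2=ar^2$ (`tendsto_annealedPressure`).

Gibbs' inequality identifies this maximum with that of $H$ when $B\ne0$: `entropy_add_le` and
`le_entropy_dualPoint` are the two halves of the duality. Strict concavity of $H$ comes from
regrouping its entropies into concave terms (`entropy_eq`), and the duality also places the maximum
point in the interior. At $B=0$ one has $v=0$ and the maximum is at the origin.

For the magnetization, the limiting pressure is differentiated by an envelope argument if $B\ne0$
and by a squeeze if $B=0$. The finite-volume pressures are convex in $B$ with derivative the
magnetization, so the derivatives converge too (`tendsto_deriv_of_convexOn`). The limit is convex,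
even and differentiable at every field, which forces its derivative to vanish as $B\to0^+$
(`tendsto_deriv_zero_of_even_convexOn`). -/

/-- Perfect matchings of `E`, as fixed-point-free involutions. -/
abbrev Matching (E : Type*) : Type _ := {π : Equiv.Perm E // ∀ h, π (π h) = h ∧ π h ≠ h}

lemma Matching.cycleType_eq {E : Type*} [Fintype E] [DecidableEq E] (π : Matching E) :
    π.1.cycleType = Multiset.replicate π.1.cycleType.card 2 := by
  refine Multiset.eq_replicate_card.2 fun n hn => ?_
  have h1 : n ∣ orderOf π.1 := Equiv.Perm.dvd_of_mem_cycleType hn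
  have h2 : orderOf π.1 ∣ 2 := by
    apply orderOf_dvd_of_pow_eq_one
    ext h
    simp [pow_two, (π.2 h).1]
  have h3 := Equiv.Perm.two_le_of_mem_cycleType hn
  have h4 := Nat.le_of_dvd two_pos (h1.trans h2)
  omega

lemma Matching.two_mul_card_cycleType {E : Type*} [Fintype E] [DecidableEq E] (π : Matching E) :
    2 * π.1.cycleType.card = Fintype.card E := by
  have h1 := π.1.sum_cycleType
  rw [π.cycleType_eq, Multiset.sum_replicate] at h1
  have h2 : π.1.support = Finset.univ := by
    ext h
    simp [(π.2 h).2]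
  rw [h2, Finset.card_univ, smul_eq_mul] at h1
  omega

lemma even_card_of_matching {E : Type*} [Fintype E] (π : Matching E) : Even (Fintype.card E) := by
  classical
  exact ⟨_, by rw [← π.two_mul_card_cycleType, two_mul]⟩

/-- The number of perfect matchings of a set with `2 m` elements. -/
lemma card_matching {E : Type*} [Fintype E] [Fintype (Matching E)] {m : ℕ}
    (hE : Fintype.card E = 2 * m) :
    Fintype.card (Matching E) * (2 ^ m * m.factorial) = (2 * m).factorial := by
  classical
  have key := Equiv.Perm.card_of_cycleType_mul_eq E (Multiset.replicate m 2)
  have h1 : Fintype.card (Matching E)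
      = (Finset.univ.filter fun g : Equiv.Perm E => g.cycleType = Multiset.replicate m 2).card := by
    rw [Fintype.card_of_subtype]
    intro g
    simp only [Finset.mem_filter, Finset.mem_univ, true_and]
    constructor
    · intro hg h
      have hs : g.support = Finset.univ := by
        rw [← Finset.card_eq_iff_eq_univ, ← g.sum_cycleType, hg, hE]
        simp [mul_comm]
      have hd : orderOf g ∣ 2 := by
        rw [← g.lcm_cycleType, hg, Multiset.lcm_dvd]
        intro b hb
        rw [Multiset.eq_of_mem_replicate hb]
      have h2 := orderOf_dvd_iff_pow_eq_one.1 hd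
      refine ⟨by simpa [pow_two] using congrArg (fun f : Equiv.Perm E => f h) h2, ?_⟩
      have : h ∈ g.support := by rw [hs]; exact Finset.mem_univ h
      exact Equiv.Perm.mem_support.1 this
    · intro hg
      have h2 := Matching.cycleType_eq ⟨g, hg⟩
      have h3 := Matching.two_mul_card_cycleType ⟨g, hg⟩
      rw [h2]
      congr 1
      simp only at h3 ⊢
      omega
  -- The only cycle length is 2, with multiplicity `m`; for `m = 0` no length occurs and the product
  -- is empty.
  have h4 : ∏ n ∈ (Multiset.replicate m 2).toFinset, ((Multiset.replicate m 2).count n).factorial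
      = m.factorial := by
    rcases Nat.eq_zero_or_pos m with rfl | hm
    · simp
    · rw [Multiset.toFinset_replicate, if_neg hm.ne']
      simp
  rw [h4, if_pos ⟨by simp [hE, mul_comm], fun a ha => (Multiset.eq_of_mem_replicate ha).ge⟩] at key
  rw [h1, ← hE, ← key]
  simp [hE, mul_comm]

/-- A matching that preserves a colouring consists of a matching of each colour class. -/
def matchingColourEquiv {E : Type*} (c : E → Bool) :
    {π : Matching E // ∀ h, c (π.1 h) = c h} ≃ ((b : Bool) → Matching {h : E // c h = b}) where
  toFun π b :=
    ⟨π.1.1.subtypePerm (fun h => by rw [π.2 h]), fun h => by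
      refine ⟨Subtype.ext ?_, fun e => (π.1.2 h).2 (congrArg Subtype.val e)⟩
      simp [(π.1.2 h).1]⟩
  invFun f := by
    have hc : ∀ h, c ((f (c h)).1 ⟨h, rfl⟩).1 = c h := fun h => ((f (c h)).1 ⟨h, rfl⟩).2
    -- The image of `h` has colour `c h` only propositionally, so going back and forth needs a
    -- transport between the matchings of equal colour classes.
    have key : ∀ h (b : Bool) (hb : c h = b), (f (c h)).1 ⟨h, rfl⟩ = ((f b).1 ⟨h, hb⟩).1 := by
      rintro h b rfl
      rfl
    have inv : ∀ h, ((f (c ((f (c h)).1 ⟨h, rfl⟩).1)).1 ⟨((f (c h)).1 ⟨h, rfl⟩).1, rfl⟩).1 = h := by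
      intro h
      rw [key _ (c h) (hc h)]
      simp [((f (c h)).2 ⟨h, rfl⟩).1]
    exact ⟨⟨⟨fun h => ((f (c h)).1 ⟨h, rfl⟩).1, fun h => ((f (c h)).1 ⟨h, rfl⟩).1, inv, inv⟩,
      fun h => ⟨inv h, fun e => ((f (c h)).2 ⟨h, rfl⟩).2 (Subtype.ext e)⟩⟩, hc⟩
  left_inv π := by
    ext h
    rfl
  right_inv f := by
    ext b ⟨h, hb⟩
    subst hb
    rfl

lemma card_matching_colour {E : Type*} [Fintype E] [DecidableEq E] (c : E → Bool) :
    Fintype.card {π : Matching E // ∀ h, c (π.1 h) = c h}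
      = Fintype.card (Matching {h : E // c h = true})
        * Fintype.card (Matching {h : E // c h = false}) := by
  rw [Fintype.card_congr (matchingColourEquiv c), Fintype.card_pi]
  simp

/-! ### Colour expansion -/

/-- Products over `E` in terms of representatives of the pairs of a matching. -/
lemma exists_representatives {E : Type*} [Fintype E] [DecidableEq E] (π : Matching E) :
    ∃ R : Finset E, (∀ h, h ∈ R ↔ π.1 h ∉ R) ∧
      ∀ G : E → ℝ, ∏ h, G h = ∏ h ∈ R, G h * G (π.1 h) := by
  -- An arbitrary enumeration selects from each pair its smaller element.
  let e := Fintype.equivFin E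
  have hne : ∀ h, e h ≠ e (π.1 h) := fun h he => (π.2 h).2 (e.injective he).symm
  have hR : ∀ h, h ∈ Finset.univ.filter (fun h => e h < e (π.1 h)) ↔
      π.1 h ∉ Finset.univ.filter (fun h => e h < e (π.1 h)) := by
    intro h
    simp only [Finset.mem_filter, Finset.mem_univ, true_and, (π.2 h).1, not_lt]
    exact ⟨le_of_lt, fun hl => lt_of_le_of_ne hl (hne h)⟩
  refine ⟨Finset.univ.filter fun h => e h < e (π.1 h), hR, fun G => ?_⟩
  rw [← Finset.prod_filter_mul_prod_filter_not Finset.univ (fun h => e h < e (π.1 h)),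
    Finset.prod_mul_distrib]
  congr 1
  symm
  refine Finset.prod_bij' (fun h _ => π.1 h) (fun h _ => π.1 h) ?_ ?_ ?_ ?_ ?_
  · intro h hh
    simpa using (hR h).1 hh
  · intro h hh
    rw [hR, (π.2 h).1]
    simpa using hh
  · exact fun h _ => (π.2 h).1
  · exact fun h _ => (π.2 h).1
  · exact fun h _ => rfl

/-- A product of two-colour kernels over the pairs of a matching, expanded over the colourings that
the matching preserves. -/
lemma sum_invariant_colouring {E : Type*} [Fintype E] [DecidableEq E] (π : Matching E)
    (F : Bool → E → ℝ) (k : E → ℝ) (hk : ∀ h, k h = k (π.1 h))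
    (hF : ∀ h, ∑ b, F b h * F b (π.1 h) = k h * k h) :
    ∑ c : E → Bool, (if ∀ h, c (π.1 h) = c h then ∏ h, F (c h) h else 0) = ∏ h, k h := by
  obtain ⟨R, hR, hprod⟩ := exists_representatives π
  have hR' : ∀ h, h ∉ R → π.1 h ∈ R := fun h hh => by
    by_contra h2
    exact hh ((hR h).2 h2)
  rw [hprod, ← Finset.prod_coe_sort, ← Finset.sum_filter]
  have e1 : ∀ h : R, k h * k (π.1 h) = ∑ b, F b h * F b (π.1 h) := fun h => by
    rw [hF, ← hk]
  simp_rw [e1]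
  rw [Fintype.prod_sum]
  -- An invariant colouring is the same as a free colouring of the representatives, extended by the
  -- colour of the partner.
  refine Finset.sum_bij' (fun c _ (h : R) => c h)
    (fun c _ h => if hh : h ∈ R then c ⟨h, hh⟩ else c ⟨π.1 h, hR' h hh⟩) ?_ ?_ ?_ ?_ ?_
  · simp
  · intro c _
    simp only [Finset.mem_filter, Finset.mem_univ, true_and]
    intro h
    by_cases hh : h ∈ R
    · have := (hR h).1 hh
      simp [hh, this, (π.2 h).1]
    · have := hR' h hh
      simp [hh, this]
  · intro c hc
    simp only [Finset.mem_filter, Finset.mem_univ, true_and] at hc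
    ext h
    by_cases hh : h ∈ R
    · simp [hh]
    · simp [hh, hc]
  · intro c _
    ext h
    simp
  · intro c hc
    simp only [Finset.mem_filter, Finset.mem_univ, true_and] at hc
    rw [hprod, ← Finset.prod_coe_sort]
    simp [hc]

/-! ### The averaged partition function as a sum over vertex colourings -/

/-- The number of half-edges at vertices of colour `b`. -/
def colourDegree {N : ℕ} (d : Fin N → ℕ) (c : Fin N → Bool) (b : Bool) : ℕ :=
  ∑ i, if c i = b then d i else 0

lemma colourDegree_add {N : ℕ} (d : Fin N → ℕ) (c : Fin N → Bool) :
    colourDegree d c true + colourDegree d c false = ∑ i, d i := by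
  rw [colourDegree, colourDegree, ← Finset.sum_add_distrib]
  refine Finset.sum_congr rfl fun i _ => ?_
  cases c i <;> simp

lemma card_colour_class {N : ℕ} (d : Fin N → ℕ) (c : Fin N → Bool) (b : Bool) :
    Fintype.card {h : HalfEdge d // c h.1 = b} = colourDegree d c b := by
  rw [Fintype.card_subtype, Finset.card_filter, Fintype.sum_sigma, colourDegree]
  refine Finset.sum_congr rfl fun i _ => ?_
  split_ifs <;> simp

lemma card_halfEdge {N : ℕ} (d : Fin N → ℕ) : Fintype.card (HalfEdge d) = ∑ i, d i := by
  simp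

/-- The weight `(2l-1)!! (2m-2l-1)!! / (2m-1)!!`: the probability that a uniform matching of `2 m` points
preserves a given colouring with `2 l` points of the second colour. -/
noncomputable def pairWeight (m l : ℕ) : ℝ :=
  (Nat.centralBinom l * Nat.centralBinom (m - l)) / (Nat.centralBinom m * m.choose l)

/-- This form of $(2m-1)!!$ suits quotients: the factorials combine to a binomial coefficient, and
the central binomials are powers of 4 up to polynomial factors. -/
lemma card_matching_eq {E : Type*} [Fintype E] [Fintype (Matching E)] {m : ℕ}
    (hE : Fintype.card E = 2 * m) :
    (Fintype.card (Matching E) : ℝ) = Nat.centralBinom m * m.factorial / 2 ^ m := by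
  have h1 := card_matching hE
  have h2 : Nat.centralBinom m * m.factorial * m.factorial = (2 * m).factorial := by
    rw [Nat.centralBinom, ← Nat.choose_mul_factorial_mul_factorial (show m ≤ 2 * m by omega)]
    congr 2
    omega
  rw [← h2] at h1
  have h3 : Fintype.card (Matching E) * 2 ^ m = Nat.centralBinom m * m.factorial :=
    Nat.eq_of_mul_eq_mul_right (Nat.factorial_pos m) (by rw [← h1]; ring)
  rw [eq_div_iff (by positivity)]
  exact_mod_cast h3

lemma card_matching_pos {E : Type*} [Fintype E] [Fintype (Matching E)] {m : ℕ}
    (hE : Fintype.card E = 2 * m) : (0 : ℝ) < Fintype.card (Matching E) := by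
  rw [card_matching_eq hE]
  have := Nat.centralBinom_pos m
  have := Nat.factorial_pos m
  positivity

/-- The two colour classes are matched separately, which is impossible when one of them has odd
size. -/
lemma card_matching_colour_div {N m : ℕ} (d : Fin N → ℕ) (hm : ∑ i, d i = 2 * m)
    (c : Fin N → Bool) :
    (Fintype.card {π : Matching (HalfEdge d) // ∀ h, c (π.1 h).1 = c h.1} : ℝ)
        / Fintype.card (Pairing d)
      = if Even (colourDegree d c false) then pairWeight m (colourDegree d c false / 2) else 0 := by
  rw [card_matching_colour (fun h : HalfEdge d => c h.1)]
  have hadd := colourDegree_add d c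
  split_ifs with hev
  · obtain ⟨l, hl⟩ := hev
    have hF := card_matching_eq (E := {h : HalfEdge d // c h.1 = false}) (m := l)
      (by rw [card_colour_class]; omega)
    have hT := card_matching_eq (E := {h : HalfEdge d // c h.1 = true}) (m := m - l)
      (by rw [card_colour_class]; omega)
    have hA := card_matching_eq (E := HalfEdge d) (m := m) (by rw [card_halfEdge]; exact hm)
    have hlm : l ≤ m := by omega
    have hl2 : colourDegree d c false / 2 = l := by omega
    push_cast
    rw [hF, hT, hA, hl2, pairWeight]
    have h1 : ((m.choose l : ℕ) : ℝ) * l.factorial * (m - l).factorial = m.factorial := by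
      exact_mod_cast Nat.choose_mul_factorial_mul_factorial hlm
    have h2 : (2 : ℝ) ^ m = 2 ^ l * 2 ^ (m - l) := by rw [← pow_add]; congr 1; omega
    rw [← h1, h2]
    have := Nat.centralBinom_pos m
    have := Nat.factorial_pos l
    have := Nat.factorial_pos (m - l)
    have := Nat.choose_pos hlm
    field_simp
  · have : Fintype.card (Matching {h : HalfEdge d // c h.1 = false}) = 0 := by
      rw [Fintype.card_eq_zero_iff]
      refine ⟨fun π => hev ?_⟩
      have := even_card_of_matching π
      rwa [card_colour_class] at this
    rw [this]
    simp

/-- The annealed partition function, expanded over the colourings of the half-edges. -/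
lemma sum_partitionFunction {N : ℕ} (d : Fin N → ℕ) (β B : ℝ) (f : Bool → ℤˣ → ℝ)
    (hf : ∀ σ τ : ℤˣ, ∑ b, f b σ * f b τ = Real.exp (β * (((σ : ℤ) : ℝ) * ((τ : ℤ) : ℝ)))) :
    ∑ π : Pairing d, partitionFunction β B π
      = ∑ c : HalfEdge d → Bool,
          (Fintype.card {π : Pairing d // ∀ h, c (π.1 h) = c h} : ℝ) *
          ∏ i, ∑ σ : ℤˣ, Real.exp (B * ((σ : ℤ) : ℝ)) * ∏ j, f (c ⟨i, j⟩) σ := by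
  have h1 : ∀ (π : Pairing d) (σ : Fin N → ℤˣ), boltzmannWeight β B π σ
      = ∑ c : HalfEdge d → Bool, if ∀ h, c (π.1 h) = c h then
          ∏ i, (Real.exp (B * (((σ i : ℤˣ) : ℤ) : ℝ)) * ∏ j, f (c ⟨i, j⟩) (σ i)) else 0 := by
    intro π σ
    -- Each half-edge carries the square root of the weight of its edge, so the product over
    -- half-edges is the product over edges.
    have h2 := sum_invariant_colouring π (fun b h => f b (σ h.1))
      (fun h => Real.exp (β * (1 / 2) * (spin σ h.1 * spin σ (π.1 h).1)))
      (fun h => by rw [(π.2 h).1, mul_comm (spin σ h.1)])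
      (fun h => by
        rw [hf, ← Real.exp_add]
        congr 1
        simp only [spin]
        ring)
    rw [boltzmannWeight, Real.exp_add, edgeSum, totalSpin, Finset.mul_sum, Finset.mul_sum,
      Finset.mul_sum, Real.exp_sum]
    simp only [← mul_assoc]
    simp only [← mul_assoc] at h2
    rw [← h2, Real.exp_sum, Finset.sum_mul]
    refine Finset.sum_congr rfl fun c _ => ?_
    split_ifs
    · rw [Finset.prod_mul_distrib, mul_comm, Fintype.prod_sigma]
      rfl
    · simp
  simp only [partitionFunction, h1]
  have h3 : ∀ π : Pairing d, (∑ σ : Fin N → ℤˣ, ∑ c : HalfEdge d → Bool,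
        if ∀ h, c (π.1 h) = c h then
          ∏ i, (Real.exp (B * (((σ i : ℤˣ) : ℤ) : ℝ)) * ∏ j, f (c ⟨i, j⟩) (σ i)) else 0)
      = ∑ c : HalfEdge d → Bool, if ∀ h, c (π.1 h) = c h then
          ∏ i, ∑ σ : ℤˣ, Real.exp (B * ((σ : ℤ) : ℝ)) * ∏ j, f (c ⟨i, j⟩) σ else 0 := by
    intro π
    rw [Finset.sum_comm]
    refine Finset.sum_congr rfl fun c _ => ?_
    split_ifs
    · rw [Fintype.prod_sum]
    · simp
  simp only [h3]
  rw [Finset.sum_comm]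
  refine Finset.sum_congr rfl fun c _ => ?_
  rw [← Finset.sum_filter, Finset.sum_const, nsmul_eq_mul, Fintype.card_subtype]

/-- The product of the vertex factors of a vertex colouring. -/
def colourWeight {N : ℕ} (d : Fin N → ℕ) (u L : Bool → ℝ) (c : Fin N → Bool) : ℝ :=
  ∏ i, if d i = 1 then u (c i) else L (c i)

/-- The annealed partition function, expanded over the colourings of the vertices. -/
lemma cmExpect_partitionFunction {N m : ℕ} (d : Fin N → ℕ) (hd : ∀ i, d i = 1 ∨ d i = 2)
    (hm : ∑ i, d i = 2 * m) (β B : ℝ) (f : Bool → ℤˣ → ℝ) (u L : Bool → ℝ)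
    (hf : ∀ σ τ : ℤˣ, ∑ b, f b σ * f b τ = Real.exp (β * (((σ : ℤ) : ℝ) * ((τ : ℤ) : ℝ))))
    (hu : ∀ b, ∑ σ : ℤˣ, Real.exp (B * ((σ : ℤ) : ℝ)) * f b σ = u b)
    (hL : ∀ b b', ∑ σ : ℤˣ, Real.exp (B * ((σ : ℤ) : ℝ)) * (f b σ * f b' σ)
      = if b = b' then L b else 0) :
    cmExpect d (partitionFunction β B)
      = ∑ c : Fin N → Bool, (if Even (colourDegree d c false) then
          pairWeight m (colourDegree d c false / 2) else 0) * colourWeight d u L c := by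
  have h0 : ∀ i, 0 < d i := fun i => by rcases hd i with h | h <;> omega
  rw [cmExpect, sum_partitionFunction d β B f hf, Finset.sum_div]
  symm
  -- Vertex colourings are the half-edge colourings that are constant at each vertex. Any other one
  -- has a vertex of degree two with two different colours, where `hL` makes the factor vanish.
  refine Finset.sum_of_injOn (fun c h => c h.1) ?_ (fun _ _ => Finset.mem_coe.2 (Finset.mem_univ _))
    ?_ ?_
  · intro c _ c' _ h
    ext i
    exact congrFun h ⟨i, ⟨0, h0 i⟩⟩
  · intro c _ hc
    have : ∃ i, ∃ j k : Fin (d i), c ⟨i, j⟩ ≠ c ⟨i, k⟩ := by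
      by_contra! hcon
      refine hc ⟨fun i => c ⟨i, ⟨0, h0 i⟩⟩, Finset.mem_coe.2 (Finset.mem_univ _), ?_⟩
      ext ⟨i, j⟩
      rw [hcon i j ⟨0, h0 i⟩]
    obtain ⟨i, hi⟩ := this
    have hz : ∑ σ : ℤˣ, Real.exp (B * ((σ : ℤ) : ℝ)) * ∏ j, f (c ⟨i, j⟩) σ = 0 := by
      revert hi
      -- The colours at `i` become a function on `Fin (d i)`, so that the value of `d i` can be
      -- substituted.
      generalize hg : (fun j : Fin (d i) => c ⟨i, j⟩) = g
      have hg' : ∀ j, c ⟨i, j⟩ = g j := fun j => congrFun hg j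
      simp only [hg']
      clear hg hg'
      rcases hd i with h | h
      · revert g
        rw [h]
        rintro g ⟨j, k, hjk⟩
        exact absurd (by rw [Subsingleton.elim j k]) hjk
      · revert g
        rw [h]
        rintro g ⟨j, k, hjk⟩
        have : g 0 ≠ g 1 := by
          fin_cases j <;> fin_cases k <;> simp_all [eq_comm]
        simp only [Fin.prod_univ_two]
        rw [hL, if_neg this]
    rw [Finset.prod_eq_zero (Finset.mem_univ i) hz]
    simp
  · intro c _
    rw [mul_div_right_comm, card_matching_colour_div d hm c]
    congr 1
    refine Finset.prod_congr rfl fun i _ => ?_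
    simp only [Finset.prod_const, Finset.card_univ, Fintype.card_fin]
    rcases hd i with h | h
    · rw [if_pos h, ← hu]
      simp [h]
    · have := hL (c i) (c i)
      rw [if_pos rfl] at this
      rw [if_neg (by omega), ← this]
      simp [h, pow_two]

/-! ### Two-sided bounds on the averaged partition function -/

/-- The summand `1` is there for `n = 0`. -/
lemma four_pow_le_mul_centralBinom (n : ℕ) :
    (4 : ℝ) ^ n ≤ (2 * n + 1) * Nat.centralBinom n := by
  rcases Nat.eq_zero_or_pos n with rfl | hn
  · simp
  · have h := Nat.four_pow_le_two_mul_self_mul_centralBinom n hn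
    have h' : (4 : ℝ) ^ n ≤ 2 * n * Nat.centralBinom n := by exact_mod_cast h
    have : (0 : ℝ) ≤ Nat.centralBinom n := by positivity
    linarith

lemma centralBinom_le_four_pow (n : ℕ) : (Nat.centralBinom n : ℝ) ≤ 4 ^ n := by
  have h : Nat.centralBinom n ≤ 2 ^ (2 * n) := by
    rw [Nat.centralBinom, ← Nat.sum_range_choose]
    exact Finset.single_le_sum (f := fun i => (2 * n).choose i) (fun _ _ => Nat.zero_le _)
      (by simp; omega)
  rw [pow_mul] at h
  exact_mod_cast h

/-- The powers of 4 that compare with the three central binomials cancel, since $4^m=4^l4^{m-l}$;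
what remains is the inverse binomial coefficient. The lower bound below is the same computation. -/
lemma pairWeight_le {m l : ℕ} (hl : l ≤ m) : pairWeight m l ≤ (2 * m + 1) / m.choose l := by
  have h1 := centralBinom_le_four_pow l
  have h2 := centralBinom_le_four_pow (m - l)
  have h3 := four_pow_le_mul_centralBinom m
  have h4 : (4 : ℝ) ^ m = 4 ^ l * 4 ^ (m - l) := by rw [← pow_add]; congr 1; omega
  have h5 : (0 : ℝ) < Nat.centralBinom m := by exact_mod_cast Nat.centralBinom_pos m
  have h6 : (0 : ℝ) < m.choose l := by exact_mod_cast Nat.choose_pos hl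
  rw [pairWeight, div_le_div_iff₀ (by positivity) h6, ← mul_assoc]
  refine mul_le_mul_of_nonneg_right ?_ h6.le
  refine le_trans ?_ h3
  rw [h4]
  gcongr

lemma le_pairWeight {m l : ℕ} (hl : l ≤ m) :
    1 / ((2 * m + 1) ^ 2 * m.choose l) ≤ pairWeight m l := by
  have h1 := four_pow_le_mul_centralBinom l
  have h2 := four_pow_le_mul_centralBinom (m - l)
  have h3 := centralBinom_le_four_pow m
  have h4 : (4 : ℝ) ^ m = 4 ^ l * 4 ^ (m - l) := by rw [← pow_add]; congr 1; omega
  have h5 : (0 : ℝ) < Nat.centralBinom m := by exact_mod_cast Nat.centralBinom_pos m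
  have h6 : (0 : ℝ) < m.choose l := by exact_mod_cast Nat.choose_pos hl
  have h7 : (l : ℝ) ≤ m := by exact_mod_cast hl
  have h8 : ((m - l : ℕ) : ℝ) ≤ m := by exact_mod_cast Nat.sub_le m l
  rw [pairWeight, div_le_div_iff₀ (by positivity) (by positivity), one_mul, ← mul_assoc]
  refine mul_le_mul_of_nonneg_right ?_ h6.le
  calc (Nat.centralBinom m : ℝ) ≤ 4 ^ l * 4 ^ (m - l) := h4 ▸ h3
    _ ≤ ((2 * l + 1) * Nat.centralBinom l) *
        ((2 * (m - l : ℕ) + 1) * Nat.centralBinom (m - l)) := by gcongr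
    _ = (Nat.centralBinom l * Nat.centralBinom (m - l)) *
        ((2 * l + 1) * (2 * (m - l : ℕ) + 1)) := by ring
    _ ≤ (Nat.centralBinom l * Nat.centralBinom (m - l)) * ((2 * m + 1) * (2 * m + 1)) := by gcongr
    _ = _ := by ring

/-- A single term in the binomial expansion of $(x^2+y^2)^m=1$. -/
lemma choose_mul_pow_le {m l : ℕ} (hl : l ≤ m) {x y : ℝ} (hxy : x ^ 2 + y ^ 2 = 1) :
    (m.choose l : ℝ) * (x ^ (2 * (m - l)) * y ^ (2 * l)) ≤ 1 := by
  have h : (y ^ 2 + x ^ 2) ^ m = 1 := by rw [add_comm, hxy, one_pow]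
  rw [add_pow] at h
  rw [← h, pow_mul, pow_mul]
  have := Finset.single_le_sum
    (f := fun k => (y ^ 2) ^ k * (x ^ 2) ^ (m - k) * (m.choose k : ℝ))
    (fun k _ => by positivity) (Finset.mem_range.2 (Nat.lt_succ_of_le hl))
  refine le_trans (le_of_eq ?_) this
  ring

/-- The terms of a binomial distribution are largest at the mean. -/
lemma choose_mul_pow_le_mode {m l : ℕ} (hl : l ≤ m) (i : ℕ) (hi : i ≤ m) :
    m.choose i * (l ^ i * (m - l) ^ (m - i)) ≤ m.choose l * (l ^ l * (m - l) ^ (m - l)) := by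
  have step : ∀ i, i < m → m.choose (i + 1) * (i + 1) = m.choose i * (m - i) := fun i _ =>
    Nat.choose_succ_right_eq m i
  -- Walk away from the mean in both directions. The quotient of the terms at $i+1$ and $i$ is
  -- $(m-i)l/((i+1)(m-l))$, at least 1 for $i<l$ and at most 1 for $i\ge l$; the inequalities are
  -- kept multiplied out, as the denominator may vanish.
  have up : ∀ j, j ≤ l → m.choose (l - j) * (l ^ (l - j) * (m - l) ^ (m - (l - j)))
      ≤ m.choose l * (l ^ l * (m - l) ^ (m - l)) := by
    intro j
    induction j with
    | zero => intro _; simp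
    | succ j ih =>
      intro hj
      refine le_trans ?_ (ih (by omega))
      obtain ⟨i, hi⟩ : ∃ i, l - (j + 1) = i := ⟨_, rfl⟩
      have e1 : l - j = i + 1 := by omega
      obtain ⟨k, hk⟩ : ∃ k, m - (i + 1) = k := ⟨_, rfl⟩
      have e2 : m - i = k + 1 := by omega
      rw [hi, e1, e2, hk, pow_succ, pow_succ]
      have hs := step i (by omega)
      rw [e2] at hs
      have hle : (i + 1) * (m - l) ≤ (k + 1) * l := by
        obtain ⟨w, rfl⟩ := Nat.exists_eq_add_of_le hl
        simp only [Nat.add_sub_cancel_left]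
        obtain ⟨v, hv⟩ := Nat.exists_eq_add_of_le (show i + 1 ≤ l by omega)
        have : k = v + w := by omega
        subst this
        rw [hv]
        nlinarith
      have : (m.choose i * (l ^ i * ((m - l) ^ k * (m - l)))) * (i + 1)
          ≤ (m.choose (i + 1) * (l ^ i * l * (m - l) ^ k)) * (i + 1) := by
        calc _ = m.choose i * (l ^ i * (m - l) ^ k) * ((i + 1) * (m - l)) := by ring
          _ ≤ m.choose i * (l ^ i * (m - l) ^ k) * ((k + 1) * l) := by gcongr
          _ = m.choose i * (k + 1) * (l ^ i * l * (m - l) ^ k) := by ring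
          _ = _ := by rw [← hs]; ring
      exact Nat.le_of_mul_le_mul_right this (Nat.succ_pos i)
  have down : ∀ j, l + j ≤ m → m.choose (l + j) * (l ^ (l + j) * (m - l) ^ (m - (l + j)))
      ≤ m.choose l * (l ^ l * (m - l) ^ (m - l)) := by
    intro j
    induction j with
    | zero => intro _; simp
    | succ j ih =>
      intro hj
      refine le_trans ?_ (ih (by omega))
      obtain ⟨i, hi⟩ : ∃ i, l + j = i := ⟨_, rfl⟩
      have e1 : l + (j + 1) = i + 1 := by omega
      obtain ⟨k, hk⟩ : ∃ k, m - (i + 1) = k := ⟨_, rfl⟩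
      have e2 : m - i = k + 1 := by omega
      rw [hi, e1, e2, hk, pow_succ, pow_succ]
      have hs := step i (by omega)
      rw [e2] at hs
      have hle : (k + 1) * l ≤ (i + 1) * (m - l) := by
        obtain ⟨w, hw⟩ : ∃ w, m - l = w := ⟨_, rfl⟩
        have : k + 1 + j = w := by omega
        rw [hw, ← hi, ← this]
        nlinarith
      have : (m.choose (i + 1) * (l ^ i * l * (m - l) ^ k)) * (i + 1)
          ≤ (m.choose i * (l ^ i * ((m - l) ^ k * (m - l)))) * (i + 1) := by
        calc _ = m.choose (i + 1) * (i + 1) * (l ^ i * l * (m - l) ^ k) := by ring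
          _ = m.choose i * (l ^ i * (m - l) ^ k) * ((k + 1) * l) := by rw [hs]; ring
          _ ≤ m.choose i * (l ^ i * (m - l) ^ k) * ((i + 1) * (m - l)) := by gcongr
          _ = _ := by ring
      exact Nat.le_of_mul_le_mul_right this (Nat.succ_pos i)
  rcases le_total i l with h | h
  · have := up (l - i) (Nat.sub_le _ _)
    rwa [show l - (l - i) = i by omega] at this
  · obtain ⟨j, rfl⟩ := Nat.exists_eq_add_of_le h
    exact down j hi

/-- Take $y^2=l/m$, so that the binomial distribution has mean $l$: its $l$-th term is the largest
of $m+1$ terms with sum 1. -/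
lemma exists_one_div_choose_le {m l : ℕ} (hl : l ≤ m) :
    ∃ x y : ℝ, 0 ≤ x ∧ 0 ≤ y ∧ x ^ 2 + y ^ 2 = 1 ∧
      1 / (m.choose l : ℝ) ≤ (m + 1) * (x ^ (2 * (m - l)) * y ^ (2 * l)) := by
  rcases Nat.eq_zero_or_pos m with rfl | hm
  · obtain rfl : l = 0 := by omega
    exact ⟨1, 0, by norm_num, le_rfl, by norm_num, by simp⟩
  have hm' : (0 : ℝ) < m := by exact_mod_cast hm
  have hlm : (l : ℝ) ≤ m := by exact_mod_cast hl
  have hx : (0 : ℝ) ≤ (m - l) / m := div_nonneg (by linarith) hm'.le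
  have hy : (0 : ℝ) ≤ l / m := by positivity
  refine ⟨√((m - l) / m), √(l / m), Real.sqrt_nonneg _, Real.sqrt_nonneg _, ?_, ?_⟩
  · rw [Real.sq_sqrt hx, Real.sq_sqrt hy]
    field_simp
    ring
  · rw [pow_mul, pow_mul, Real.sq_sqrt hx, Real.sq_sqrt hy]
    have h6 : (0 : ℝ) < m.choose l := by exact_mod_cast Nat.choose_pos hl
    rw [div_le_iff₀ h6]
    have hsum : (m : ℝ) ^ m = ∑ i ∈ Finset.range (m + 1),
        ((m.choose i * (l ^ i * (m - l) ^ (m - i)) : ℕ) : ℝ) := by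
      have : m ^ m = (l + (m - l)) ^ m := by congr 1; omega
      rw [add_pow] at this
      have h2 : m ^ m = ∑ i ∈ Finset.range (m + 1), m.choose i * (l ^ i * (m - l) ^ (m - i)) := by
        rw [this]
        exact Finset.sum_congr rfl fun i _ => by rw [Nat.cast_id]; ring
      exact_mod_cast h2
    have hle : (m : ℝ) ^ m ≤ (m + 1) * (m.choose l * (l ^ l * (m - l) ^ (m - l))) := by
      rw [hsum]
      calc _ ≤ ∑ i ∈ Finset.range (m + 1),
            ((m.choose l * (l ^ l * (m - l) ^ (m - l)) : ℕ) : ℝ) :=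
          Finset.sum_le_sum fun i hi => Nat.cast_le.2
            (choose_mul_pow_le_mode hl i (by simpa [Nat.lt_succ_iff] using hi))
        _ = _ := by
          rw [Finset.sum_const, Finset.card_range, nsmul_eq_mul]
          push_cast [Nat.cast_sub hl]
          ring
    have h4 : (m : ℝ) ^ m = m ^ (m - l) * m ^ l := by rw [← pow_add]; congr 1; omega
    rw [div_pow, div_pow]
    calc (1 : ℝ) = m ^ m / m ^ m := (div_self (by positivity)).symm
      _ ≤ (m + 1) * (m.choose l * (l ^ l * (m - l) ^ (m - l))) / m ^ m := by gcongr
      _ = _ := by rw [h4]; field_simp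

/-- The summand is a product over vertices, so the sum over colourings factorises. Arbitrary real
`x` and `y` are allowed because a negative `y` is needed later. -/
lemma sum_colourWeight {N : ℕ} (d : Fin N → ℕ) (hd : ∀ i, d i = 1 ∨ d i = 2) (u L : Bool → ℝ)
    (x y : ℝ) {n1 n2 : ℕ} (h1 : (Finset.univ.filter fun i => d i = 1).card = n1)
    (h2 : (Finset.univ.filter fun i => d i = 2).card = n2) :
    ∑ c : Fin N → Bool, colourWeight d u L c *
        (x ^ colourDegree d c true * y ^ colourDegree d c false)
      = (u true * x + u false * y) ^ n1 * (L true * x ^ 2 + L false * y ^ 2) ^ n2 := by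
  have e : ∀ c : Fin N → Bool, colourWeight d u L c *
        (x ^ colourDegree d c true * y ^ colourDegree d c false)
      = ∏ i, (if d i = 1 then u (c i) else L (c i)) * (if c i = true then x else y) ^ d i := by
    intro c
    rw [colourWeight, colourDegree, colourDegree, ← Finset.prod_pow_eq_pow_sum,
      ← Finset.prod_pow_eq_pow_sum, ← Finset.prod_mul_distrib, ← Finset.prod_mul_distrib]
    refine Finset.prod_congr rfl fun i _ => ?_
    cases c i <;> simp
  simp only [e]
  rw [← Fintype.prod_sum
    (f := fun i b => (if d i = 1 then u b else L b) * (if b = true then x else y) ^ d i),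
    ← Finset.prod_filter_mul_prod_filter_not Finset.univ (fun i => d i = 1)]
  congr 1
  · rw [← h1, ← Finset.prod_const]
    refine Finset.prod_congr rfl fun i hi => ?_
    simp [(Finset.mem_filter.1 hi).2]
  · rw [← h2, ← Finset.prod_const]
    refine Finset.prod_congr ?_ fun i hi => ?_
    · ext i
      rcases hd i with h | h <;> simp [h]
    · simp [(Finset.mem_filter.1 hi).2]

lemma sum_degrees {N : ℕ} (d : Fin N → ℕ) (hd : ∀ i, d i = 1 ∨ d i = 2) {n1 n2 : ℕ}
    (h1 : (Finset.univ.filter fun i => d i = 1).card = n1)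
    (h2 : (Finset.univ.filter fun i => d i = 2).card = n2) : ∑ i, d i = n1 + 2 * n2 := by
  rw [← h1, ← h2, Finset.card_filter, Finset.card_filter, Finset.mul_sum,
    ← Finset.sum_add_distrib]
  refine Finset.sum_congr rfl fun i _ => ?_
  rcases hd i with h | h <;> simp [h]

lemma colourWeight_nonneg {N : ℕ} (d : Fin N → ℕ) {u L : Bool → ℝ} (hu : ∀ b, 0 ≤ u b)
    (hL : ∀ b, 0 ≤ L b) (c : Fin N → Bool) : 0 ≤ colourWeight d u L c := by
  refine Finset.prod_nonneg fun i _ => ?_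
  split_ifs
  · exact hu _
  · exact hL _

/-- Averaging the generating function over $y$ and $-y$ removes the colourings of odd degree, for
which no matching exists. The term with $-y$ can then be dropped because it is nonnegative. -/
lemma le_sum_pairWeight {N m : ℕ} (d : Fin N → ℕ) (hd : ∀ i, d i = 1 ∨ d i = 2)
    (hm : ∑ i, d i = 2 * m) {u L : Bool → ℝ} (hu : ∀ b, 0 ≤ u b) (hL : ∀ b, 0 ≤ L b)
    {n1 n2 : ℕ} (h1 : (Finset.univ.filter fun i => d i = 1).card = n1)
    (h2 : (Finset.univ.filter fun i => d i = 2).card = n2) {x y : ℝ}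
    (hxy : x ^ 2 + y ^ 2 = 1) :
    1 / (2 * (2 * m + 1) ^ 2) *
        ((u true * x + u false * y) ^ n1 * (L true * x ^ 2 + L false * y ^ 2) ^ n2)
      ≤ ∑ c : Fin N → Bool, (if Even (colourDegree d c false) then
          pairWeight m (colourDegree d c false / 2) else 0) * colourWeight d u L c := by
  -- The only factor of indefinite sign in the term with $-y$ is raised to this power.
  have hn1 : Even n1 := by
    have := sum_degrees d hd h1 h2
    rw [Nat.even_iff]
    omega
  have hs1 := sum_colourWeight d hd u L x y h1 h2
  have hs2 := sum_colourWeight d hd u L x (-y) h1 h2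
  have hpos : 0 ≤ (u true * x + u false * (-y)) ^ n1 * (L true * x ^ 2 + L false * (-y) ^ 2) ^ n2 := by
    have := hL true
    have := hL false
    have := hn1.pow_nonneg (u true * x + u false * (-y))
    positivity
  have key : ∀ c : Fin N → Bool,
      1 / (2 * (2 * m + 1) ^ 2) * (colourWeight d u L c *
        (x ^ colourDegree d c true * y ^ colourDegree d c false)
        + colourWeight d u L c * (x ^ colourDegree d c true * (-y) ^ colourDegree d c false))
      ≤ (if Even (colourDegree d c false) then
          pairWeight m (colourDegree d c false / 2) else 0) * colourWeight d u L c := by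
    intro c
    have hw := colourWeight_nonneg d hu hL c
    split_ifs with hev
    · rw [hev.neg_pow]
      obtain ⟨l, hl⟩ := hev
      have hadd := colourDegree_add d c
      have hlm : l ≤ m := by omega
      have e1 : colourDegree d c false = 2 * l := by omega
      have e2 : colourDegree d c true = 2 * (m - l) := by omega
      rw [e1, e2, Nat.mul_div_cancel_left _ two_pos]
      have hb := le_pairWeight hlm
      have hc := choose_mul_pow_le hlm hxy
      have h6 : (0 : ℝ) < m.choose l := by exact_mod_cast Nat.choose_pos hlm
      have : 1 / (2 * m + 1) ^ 2 * (x ^ (2 * (m - l)) * y ^ (2 * l)) ≤ pairWeight m l := by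
        refine le_trans ?_ hb
        rw [one_div_mul_eq_div, div_le_div_iff₀ (by positivity) (by positivity)]
        calc _ = (2 * (m : ℝ) + 1) ^ 2 * (m.choose l * (x ^ (2 * (m - l)) * y ^ (2 * l))) := by ring
          _ ≤ (2 * (m : ℝ) + 1) ^ 2 * 1 := by gcongr
          _ = _ := by ring
      calc _ = 1 / (2 * (m : ℝ) + 1) ^ 2 * (x ^ (2 * (m - l)) * y ^ (2 * l))
            * colourWeight d u L c := by field_simp; ring
        _ ≤ _ := by gcongr
    · rw [(Nat.not_even_iff_odd.1 hev).neg_pow]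
      apply le_of_eq
      ring
  refine le_trans ?_ (Finset.sum_le_sum fun c _ => key c)
  rw [← Finset.mul_sum, Finset.sum_add_distrib, hs1, hs2]
  gcongr
  linarith

/-- The near-optimal direction depends on the colouring only through $l\le m$, so the sum over all
$m+1$ of these directions dominates. This costs one factor $m+1$; the other one comes from
`exists_one_div_choose_le`. -/
lemma sum_pairWeight_le {N m : ℕ} (d : Fin N → ℕ) (hd : ∀ i, d i = 1 ∨ d i = 2)
    (hm : ∑ i, d i = 2 * m) {u L : Bool → ℝ} (hu : ∀ b, 0 ≤ u b) (hL : ∀ b, 0 ≤ L b)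
    {n1 n2 : ℕ} (h1 : (Finset.univ.filter fun i => d i = 1).card = n1)
    (h2 : (Finset.univ.filter fun i => d i = 2).card = n2) {R : ℝ}
    (hR : ∀ x y : ℝ, 0 ≤ x → 0 ≤ y → x ^ 2 + y ^ 2 = 1 →
      (u true * x + u false * y) ^ n1 * (L true * x ^ 2 + L false * y ^ 2) ^ n2 ≤ R) :
    ∑ c : Fin N → Bool, (if Even (colourDegree d c false) then
        pairWeight m (colourDegree d c false / 2) else 0) * colourWeight d u L c
      ≤ (2 * m + 1) * (m + 1) ^ 2 * R := by
  choose! x y hx hy hxy hch using fun l (hl : l ≤ m) => exists_one_div_choose_le hl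
  have key : ∀ c : Fin N → Bool, (if Even (colourDegree d c false) then
        pairWeight m (colourDegree d c false / 2) else 0) * colourWeight d u L c
      ≤ ∑ l ∈ Finset.range (m + 1), (2 * (m : ℝ) + 1) * (m + 1) * (colourWeight d u L c *
        (x l ^ colourDegree d c true * y l ^ colourDegree d c false)) := by
    intro c
    have hw := colourWeight_nonneg d hu hL c
    have hnn : ∀ l ∈ Finset.range (m + 1), 0 ≤ (2 * (m : ℝ) + 1) * (m + 1) * (colourWeight d u L c *
        (x l ^ colourDegree d c true * y l ^ colourDegree d c false)) := by
      intro l hl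
      have hl' : l ≤ m := by simpa [Nat.lt_succ_iff] using hl
      have := hx l hl'
      have := hy l hl'
      positivity
    split_ifs with hev
    · obtain ⟨l, hl⟩ := hev
      have hadd := colourDegree_add d c
      have hlm : l ≤ m := by omega
      have e1 : colourDegree d c false = 2 * l := by omega
      have e2 : colourDegree d c true = 2 * (m - l) := by omega
      refine le_trans ?_ (Finset.single_le_sum hnn (Finset.mem_range.2 (Nat.lt_succ_of_le hlm)))
      rw [e1, e2, Nat.mul_div_cancel_left _ two_pos]
      calc _ ≤ (2 * (m : ℝ) + 1) * (1 / m.choose l) * colourWeight d u L c := by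
            gcongr
            rw [mul_one_div]
            exact pairWeight_le hlm
        _ ≤ (2 * (m : ℝ) + 1) * ((m + 1) * (x l ^ (2 * (m - l)) * y l ^ (2 * l)))
            * colourWeight d u L c := by
            gcongr
            exact hch l hlm
        _ = _ := by ring
    · rw [zero_mul]
      exact Finset.sum_nonneg hnn
  refine le_trans (Finset.sum_le_sum fun c _ => key c) ?_
  rw [Finset.sum_comm]
  calc _ ≤ ∑ l ∈ Finset.range (m + 1), (2 * (m : ℝ) + 1) * (m + 1) * R := by
        refine Finset.sum_le_sum fun l hl => ?_
        have hl' : l ≤ m := by simpa [Nat.lt_succ_iff] using hl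
        rw [← Finset.mul_sum, sum_colourWeight d hd u L _ _ h1 h2]
        gcongr
        exact hR _ _ (hx l hl') (hy l hl') (hxy l hl')
    _ = _ := by
        rw [Finset.sum_const, Finset.card_range, nsmul_eq_mul]
        push_cast
        ring

/-! ### Spectral decomposition of the transfer matrix -/

section Spectral

variable {β : ℝ}

/-- The trace of the transfer matrix, which has diagonal $e^{\beta\pm B}$ and off-diagonal entries
$e^{-\beta}$. The next lemma gives its determinant. -/
lemma lamPlus_add_lamMinus (β B : ℝ) :
    lamPlus β B + lamMinus β B = Real.exp (β + B) + Real.exp (β - B) := by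
  rw [lamPlus, lamMinus, Real.exp_add, sub_eq_add_neg β, Real.exp_add, Real.cosh_eq]
  ring

lemma lamPlus_mul_lamMinus (β B : ℝ) :
    lamPlus β B * lamMinus β B = Real.exp (2 * β) - Real.exp (-2 * β) := by
  have h := Real.sq_sqrt (show 0 ≤ Real.sinh B ^ 2 + Real.exp (-4 * β) by positivity)
  have h2 := Real.cosh_sq B
  have h3 : Real.exp (2 * β) = Real.exp β ^ 2 := by rw [← Real.exp_nat_mul]; norm_num
  have h4 : Real.exp (-2 * β) = Real.exp β ^ 2 * Real.exp (-4 * β) := by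
    rw [← h3, ← Real.exp_add]; ring_nf
  rw [lamPlus, lamMinus, h4, h3]
  linear_combination (-Real.exp β ^ 2) * h + Real.exp β ^ 2 * h2

lemma lamPlus_pos (β B : ℝ) : 0 < lamPlus β B := by
  have := Real.cosh_pos B
  have := Real.exp_pos β
  rw [lamPlus]
  positivity

lemma lamMinus_pos (hβ : 0 < β) (B : ℝ) : 0 < lamMinus β B := by
  have h := lamPlus_mul_lamMinus β B
  have h2 : Real.exp (-2 * β) < Real.exp (2 * β) := Real.exp_lt_exp.2 (by linarith)
  exact pos_of_mul_pos_right (by rw [h]; linarith) (lamPlus_pos β B).le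

lemma lamMinus_lt_lamPlus (β B : ℝ) : lamMinus β B < lamPlus β B := by
  have h : 0 < √(Real.sinh B ^ 2 + Real.exp (-4 * β)) := Real.sqrt_pos.2 (by positivity)
  rw [lamPlus, lamMinus]
  exact mul_lt_mul_of_pos_left (by linarith) (Real.exp_pos β)

lemma exp_add_lt_lamPlus (β B : ℝ) : Real.exp (β + B) < lamPlus β B := by
  have h : Real.sinh B < √(Real.sinh B ^ 2 + Real.exp (-4 * β)) := by
    refine lt_of_le_of_lt (le_abs_self _) ?_
    rw [← Real.sqrt_sq_eq_abs]
    exact Real.sqrt_lt_sqrt (sq_nonneg _) (by linarith [Real.exp_pos (-4 * β)])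
  rw [Real.exp_add, lamPlus]
  refine mul_lt_mul_of_pos_left ?_ (Real.exp_pos β)
  rw [← Real.cosh_add_sinh]
  linarith

lemma rRatio_pos (hβ : 0 < β) (B : ℝ) : 0 < rRatio β B :=
  div_pos (lamMinus_pos hβ B) (lamPlus_pos β B)

lemma rRatio_lt_one (β B : ℝ) : rRatio β B < 1 := by
  rw [rRatio, div_lt_one (lamPlus_pos β B)]
  exact lamMinus_lt_lamPlus β B

/-- The characteristic equation of the transfer matrix. -/
lemma lamPlus_eigen (β B : ℝ) :
    (lamPlus β B - Real.exp (β + B)) * (lamPlus β B - Real.exp (β - B)) = Real.exp (-2 * β) := by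
  have h1 := lamPlus_add_lamMinus β B
  have h2 := lamPlus_mul_lamMinus β B
  have h3 : Real.exp (β + B) * Real.exp (β - B) = Real.exp (2 * β) := by
    rw [← Real.exp_add]; ring_nf
  linear_combination lamPlus β B * h1 - h2 + h3

/-- With $\varepsilon=e^{-\beta}$ and $\delta=\lambda_+-e^{\beta+B}$, the vector
$(\varepsilon,\delta)$ is an eigenvector for $\lambda_+$ and $(\delta,-\varepsilon)$ one for
$\lambda_-$. Thus $A_\pm\lambda_\pm$ is the squared projection of $w=(e^{B/2},e^{-B/2})$ on the
normalised eigenvector; the perfect square shows the sign. -/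
lemma APlus_mul_sq (β B : ℝ) :
    APlus β B * lamPlus β B ^ 2
      = lamPlus β B * (Real.exp (-β) * Real.exp (B / 2)
          + (lamPlus β B - Real.exp (β + B)) * Real.exp (-B / 2)) ^ 2
        / (Real.exp (-β) ^ 2 + (lamPlus β B - Real.exp (β + B)) ^ 2) := by
  have h1 : Real.exp (-2 * β) = Real.exp (-β) ^ 2 := by rw [← Real.exp_nat_mul]; ring_nf
  have h2 : Real.exp B = Real.exp (B / 2) ^ 2 := by rw [← Real.exp_nat_mul]; ring_nf
  have h3 : Real.exp (-B) = Real.exp (-B / 2) ^ 2 := by rw [← Real.exp_nat_mul]; ring_nf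
  have h4 : Real.exp (B / 2) * Real.exp (-B / 2) = 1 := by rw [← Real.exp_add]; ring_nf; simp
  have h5 := lamPlus_pos β B
  rw [APlus, h1, h2, h3]
  have h6 : 0 < Real.exp (-β) ^ 2 + (lamPlus β B - Real.exp (β + B)) ^ 2 := by positivity
  generalize lamPlus β B - Real.exp (β + B) = δ at *
  generalize Real.exp (-B / 2) = F at *
  generalize Real.exp (B / 2) = E at *
  field_simp
  linear_combination (-2 * Real.exp (-β) * δ) * h4

lemma AMinus_mul_sq (hβ : 0 < β) (B : ℝ) :
    AMinus β B * lamMinus β B ^ 2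
      = lamMinus β B * ((lamPlus β B - Real.exp (β + B)) * Real.exp (B / 2)
          - Real.exp (-β) * Real.exp (-B / 2)) ^ 2
        / (Real.exp (-β) ^ 2 + (lamPlus β B - Real.exp (β + B)) ^ 2) := by
  have h1 : Real.exp (-2 * β) = Real.exp (-β) ^ 2 := by rw [← Real.exp_nat_mul]; ring_nf
  have h2 : Real.exp B = Real.exp (B / 2) ^ 2 := by rw [← Real.exp_nat_mul]; ring_nf
  have h3 : Real.exp (-B) = Real.exp (-B / 2) ^ 2 := by rw [← Real.exp_nat_mul]; ring_nf
  have h4 : Real.exp (B / 2) * Real.exp (-B / 2) = 1 := by rw [← Real.exp_add]; ring_nf; simp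
  have h5 := lamMinus_pos hβ B
  rw [AMinus, h1, h2, h3]
  have h6 : 0 < Real.exp (-β) ^ 2 + (lamPlus β B - Real.exp (β + B)) ^ 2 := by positivity
  generalize lamPlus β B - Real.exp (β + B) = δ at *
  generalize Real.exp (-B / 2) = F at *
  generalize Real.exp (B / 2) = E at *
  field_simp
  linear_combination (2 * Real.exp (-β) * δ) * h4

lemma APlus_pos (β B : ℝ) : 0 < APlus β B := by
  have h := APlus_mul_sq β B
  have h1 := lamPlus_pos β B
  have h2 : 0 < lamPlus β B - Real.exp (β + B) := sub_pos.2 (exp_add_lt_lamPlus β B)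
  refine pos_of_mul_pos_left ?_ (sq_nonneg (lamPlus β B))
  rw [h]
  positivity

lemma AMinus_nonneg (hβ : 0 < β) (B : ℝ) : 0 ≤ AMinus β B := by
  have h := AMinus_mul_sq hβ B
  have h1 := lamMinus_pos hβ B
  refine nonneg_of_mul_nonneg_left ?_ (show 0 < lamMinus β B ^ 2 by positivity)
  rw [h]
  positivity

/-- $A_-$ vanishes exactly when $w=(e^{B/2},e^{-B/2})$ is an eigenvector for $\lambda_+$. Comparing
the two rows of the eigenvalue equation then gives $(e^\beta-e^{-\beta})(e^B-e^{-B})=0$. -/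
lemma AMinus_eq_zero_iff (hβ : 0 < β) (B : ℝ) : AMinus β B = 0 ↔ B = 0 := by
  have h := AMinus_mul_sq hβ B
  have h1 := lamMinus_pos hβ B
  have h6 : 0 < Real.exp (-β) ^ 2 + (lamPlus β B - Real.exp (β + B)) ^ 2 := by positivity
  have hiff : AMinus β B = 0 ↔ (lamPlus β B - Real.exp (β + B)) * Real.exp (B / 2)
          - Real.exp (-β) * Real.exp (-B / 2) = 0 := by
    constructor
    · intro h0
      rw [h0, zero_mul, eq_comm, div_eq_zero_iff, or_iff_left h6.ne'] at h
      simpa [h1.ne'] using h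
    · intro h0
      rw [h0] at h
      simpa [h1.ne'] using h
  rw [hiff]
  constructor
  · intro h0
    have e1 : lamPlus β B - Real.exp (β + B) = Real.exp (-β - B) := by
      have h4 : Real.exp (B / 2) * Real.exp (-B / 2) = 1 := by rw [← Real.exp_add]; ring_nf; simp
      have h5 : Real.exp (-β - B) = Real.exp (-β) * Real.exp (-B / 2) * Real.exp (-B / 2) := by
        rw [← Real.exp_add, ← Real.exp_add]; ring_nf
      rw [h5]
      linear_combination Real.exp (-B / 2) * h0 - (lamPlus β B - Real.exp (β + B)) * h4
    have e2 := lamPlus_eigen β B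
    rw [e1] at e2
    have e3 : lamPlus β B - Real.exp (β - B) = Real.exp (-β + B) := by
      have h5 : Real.exp (-2 * β) = Real.exp (-β - B) * Real.exp (-β + B) := by
        rw [← Real.exp_add]; ring_nf
      rw [h5] at e2
      exact mul_left_cancel₀ (Real.exp_pos _).ne' e2
    have e4 : (Real.exp β - Real.exp (-β)) * (Real.exp B - Real.exp (-B)) = 0 := by
      have a1 := Real.exp_add β B
      have a2 := Real.exp_add (-β) B
      have a3 := Real.exp_add β (-B)
      have a4 := Real.exp_add (-β) (-B)
      rw [← sub_eq_add_neg] at a3 a4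
      linear_combination e3 - e1 - a1 + a2 + a3 - a4
    rcases mul_eq_zero.1 e4 with h7 | h7
    · have := Real.exp_injective (sub_eq_zero.1 h7)
      linarith
    · have := Real.exp_injective (sub_eq_zero.1 h7)
      linarith
  · rintro rfl
    have : √(Real.exp (-4 * β)) = Real.exp (-2 * β) := by
      rw [show -4 * β = -2 * β + -2 * β by ring, Real.exp_add, Real.sqrt_mul_self (Real.exp_pos _).le]
    have h8 : Real.exp (-β) = Real.exp β * Real.exp (-2 * β) := by rw [← Real.exp_add]; ring_nf
    have h9 : lamPlus β 0 = Real.exp β + Real.exp (-β) := by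
      rw [lamPlus, Real.cosh_zero, Real.sinh_zero, h8, zero_pow two_ne_zero, zero_add, this]
      ring
    simp [h9]

lemma aRatio_nonneg (hβ : 0 < β) (B : ℝ) : 0 ≤ aRatio β B :=
  div_nonneg (AMinus_nonneg hβ B) (APlus_pos β B).le

lemma aRatio_eq_zero_iff (hβ : 0 < β) (B : ℝ) : aRatio β B = 0 ↔ B = 0 := by
  rw [aRatio, div_eq_zero_iff, or_iff_left (APlus_pos β B).ne', AMinus_eq_zero_iff hβ]

lemma aRatio_pos (hβ : 0 < β) {B : ℝ} (hB : B ≠ 0) : 0 < aRatio β B :=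
  lt_of_le_of_ne (aRatio_nonneg hβ B) fun h => hB ((aRatio_eq_zero_iff hβ B).1 h.symm)

/-- A decomposition of the edge weight that diagonalises the vertex factors. -/
lemma exists_colour_factors (hβ : 0 < β) (B : ℝ) :
    ∃ f : Bool → ℤˣ → ℝ,
      (∀ σ τ : ℤˣ, ∑ b, f b σ * f b τ = Real.exp (β * (((σ : ℤ) : ℝ) * ((τ : ℤ) : ℝ)))) ∧
      (∀ b, ∑ σ : ℤˣ, Real.exp (B * ((σ : ℤ) : ℝ)) * f b σ
        = if b then √(APlus β B) * lamPlus β B else √(AMinus β B) * lamMinus β B) ∧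
      (∀ b b', ∑ σ : ℤˣ, Real.exp (B * ((σ : ℤ) : ℝ)) * (f b σ * f b' σ)
        = if b = b' then (if b then lamPlus β B else lamMinus β B) else 0) := by
  obtain ⟨δ, hδ⟩ : ∃ δ, lamPlus β B - Real.exp (β + B) = δ := ⟨_, rfl⟩
  obtain ⟨ε, hε⟩ : ∃ ε, Real.exp (-β) = ε := ⟨_, rfl⟩
  have hδ0 : 0 < δ := by rw [← hδ]; exact sub_pos.2 (exp_add_lt_lamPlus β B)
  have hε0 : 0 < ε := by rw [← hε]; exact Real.exp_pos _
  have hl1 := lamPlus_pos β B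
  have hl2 := lamMinus_pos hβ B
  obtain ⟨n, hn⟩ : ∃ n, √(ε ^ 2 + δ ^ 2) = n := ⟨_, rfl⟩
  have hn0 : 0 < n := by rw [← hn]; exact Real.sqrt_pos.2 (by positivity)
  have hn2 : n ^ 2 = ε ^ 2 + δ ^ 2 := by rw [← hn, Real.sq_sqrt (by positivity)]
  obtain ⟨E, hE⟩ : ∃ E, Real.exp (B / 2) = E := ⟨_, rfl⟩
  obtain ⟨F, hF⟩ : ∃ F, Real.exp (-B / 2) = F := ⟨_, rfl⟩
  have hE0 : 0 < E := by rw [← hE]; exact Real.exp_pos _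
  have hF0 : 0 < F := by rw [← hF]; exact Real.exp_pos _
  have hEF : E * F = 1 := by rw [← hE, ← hF, ← Real.exp_add]; ring_nf; simp
  have hEB : Real.exp B = E ^ 2 := by rw [← hE, ← Real.exp_nat_mul]; ring_nf
  have hFB : Real.exp (-B) = F ^ 2 := by rw [← hF, ← Real.exp_nat_mul]; ring_nf
  have hA1 := APlus_mul_sq β B
  have hA2 := AMinus_mul_sq hβ B
  have hA0 := (APlus_pos β B).le
  have hA0' := AMinus_nonneg hβ B
  have heig := lamPlus_eigen β B
  have htr := lamPlus_add_lamMinus β B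
  have hb1 : Real.exp (β + B) = Real.exp β * E ^ 2 := by rw [Real.exp_add, hEB]
  have hb2 : Real.exp (β - B) = Real.exp β * F ^ 2 := by rw [sub_eq_add_neg, Real.exp_add, hFB]
  have hb3 : Real.exp (-2 * β) = ε ^ 2 := by rw [← hε, ← Real.exp_nat_mul]; ring_nf
  rw [hδ, hε, hE, hF, ← hn2] at hA1 hA2
  rw [hδ, hb2, hb3] at heig
  rw [hb1] at hδ
  rw [hb1, hb2] at htr
  obtain ⟨s1, hs1⟩ : ∃ s, √(lamPlus β B) = s := ⟨_, rfl⟩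
  obtain ⟨s2, hs2⟩ : ∃ s, √(lamMinus β B) = s := ⟨_, rfl⟩
  have hs1s : s1 ^ 2 = lamPlus β B := by rw [← hs1, Real.sq_sqrt hl1.le]
  have hs2s : s2 ^ 2 = lamMinus β B := by rw [← hs2, Real.sq_sqrt hl2.le]
  have hs10 : 0 < s1 := by rw [← hs1]; exact Real.sqrt_pos.2 hl1
  have hs20 : 0 < s2 := by rw [← hs2]; exact Real.sqrt_pos.2 hl2
  -- The sign of the second eigenvector is chosen to make its coefficient at a vertex of degree one
  -- nonnegative, as the square root in the claim requires.
  obtain ⟨e, he, hesq⟩ : ∃ e : ℝ, e * (δ * E - ε * F) = |δ * E - ε * F| ∧ e ^ 2 = 1 := by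
    rcases le_total 0 (δ * E - ε * F) with h | h
    · exact ⟨1, by rw [abs_of_nonneg h, one_mul], by norm_num⟩
    · exact ⟨-1, by rw [abs_of_nonpos h]; ring, by norm_num⟩
  have hu1 : √(APlus β B) * lamPlus β B = s1 * (ε * E + δ * F) / n := by
    rw [← Real.sqrt_sq hl1.le, ← Real.sqrt_mul hA0, hA1]
    rw [← Real.sqrt_sq (show 0 ≤ s1 * (ε * E + δ * F) / n by positivity)]
    congr 1
    rw [div_pow, mul_pow, hs1s]
  have hu2 : √(AMinus β B) * lamMinus β B = s2 * |δ * E - ε * F| / n := by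
    rw [← Real.sqrt_sq hl2.le, ← Real.sqrt_mul hA0', hA2]
    rw [← Real.sqrt_sq (show 0 ≤ s2 * |δ * E - ε * F| / n by positivity)]
    congr 1
    rw [div_pow, mul_pow, hs2s, sq_abs]
  -- $f_\pm(\sigma)=\sqrt{\lambda_\pm}\,\varphi_\pm(\sigma)e^{-B\sigma/2}$ with normalised
  -- eigenvectors $\varphi_\pm$: the last factor removes the field from the transfer matrix.
  refine ⟨fun b σ => if b then (if σ = 1 then s1 * ε / n * F else s1 * δ / n * E)
    else (if σ = 1 then e * s2 * δ / n * F else -(e * s2 * ε / n * E)), ?_, ?_, ?_⟩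
  · have hl : lamMinus β B = Real.exp β * F ^ 2 - δ := by linear_combination htr - hδ
    have hx : Real.exp β * E ^ 2 = lamPlus β B - δ := by linear_combination -hδ
    -- `k1`, `k2`, `k3` are the entries of the spectral decomposition, multiplied by $n^2$; in the
    -- off-diagonal one a factor $\varepsilon$ is cancelled.
    have k1 : lamPlus β B * ε ^ 2 + lamMinus β B * δ ^ 2 = Real.exp β * E ^ 2 * n ^ 2 := by
      rw [hn2, hx, hl]
      linear_combination (-δ) * heig
    have k2 : (lamPlus β B - lamMinus β B) * δ = n ^ 2 := by
      rw [hn2, hl]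
      linear_combination heig
    have k3 : lamPlus β B * δ ^ 2 + lamMinus β B * ε ^ 2 = Real.exp β * F ^ 2 * n ^ 2 := by
      rw [hn2, hl]
      linear_combination δ * heig
    intro σ τ
    rcases Int.units_eq_one_or σ with rfl | rfl <;> rcases Int.units_eq_one_or τ with rfl | rfl <;>
      simp [hε] <;> field_simp <;> rw [hs1s, hs2s, hesq]
    · linear_combination F ^ 2 * k1 + (Real.exp β * n ^ 2 * (E * F + 1)) * hEF
    · linear_combination k2 + (lamPlus β B - lamMinus β B) * δ * hEF
    · linear_combination k2 + (lamPlus β B - lamMinus β B) * δ * hEF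
    · linear_combination E ^ 2 * k3 + (Real.exp β * n ^ 2 * (E * F + 1)) * hEF
  · rintro (_ | _)
    · simp [hu2, hEB, hFB, ← he]
      field_simp
      linear_combination (e * (E * δ - F * ε)) * hEF
    · simp [hu1, hEB, hFB]
      field_simp
      linear_combination hEF
  · rintro (_ | _) (_ | _) <;> simp [hEB, hFB] <;> field_simp
    · rw [hesq, hs2s, hn2]
      linear_combination (lamMinus β B * (ε ^ 2 + δ ^ 2) * (E * F + 1)) * hEF
    · ring
    · ring
    · rw [hs1s, hn2]
      linear_combination (lamPlus β B * (ε ^ 2 + δ ^ 2) * (E * F + 1)) * hEF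

end Spectral

/-! ### The limit of the annealed pressure as a one-parameter maximum -/

lemma tendsto_log_two_mul_add_one_div :
    Tendsto (fun N : ℕ => Real.log (2 * (N : ℝ) + 1) / N) atTop (𝓝 0) := by
  have h1 : Tendsto (fun x : ℝ => Real.log x / x) atTop (𝓝 0) :=
    Real.isLittleO_log_id_atTop.tendsto_div_nhds_zero
  have h2 : Tendsto (fun N : ℕ => 2 * (N : ℝ) + 1) atTop atTop :=
    tendsto_atTop_add_const_right _ _
      (tendsto_natCast_atTop_atTop.const_mul_atTop (by norm_num : (0 : ℝ) < 2))
  have h3 : Tendsto (fun N : ℕ => 2 + 1 / (N : ℝ)) atTop (𝓝 (2 + 0)) :=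
    tendsto_const_nhds.add tendsto_one_div_atTop_nhds_zero_nat
  have h4 := (h1.comp h2).mul h3
  rw [zero_mul] at h4
  refine h4.congr' ?_
  filter_upwards [eventually_gt_atTop 0] with N hN
  have : (0 : ℝ) < N := by exact_mod_cast hN
  simp only [Function.comp]
  field_simp

section Limit

variable {p : ℝ} {N : ℕ} {d : Fin N → ℕ}

lemma card_degree_one (hd : IsOneTwoDegrees p d) :
    (Finset.univ.filter fun i => d i = 1).card = N - ⌊p * (N : ℝ)⌋₊ := by
  have h := Finset.card_filter_add_card_filter_not (s := Finset.univ) (fun i => d i = 1)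
  have h2 : (Finset.univ.filter fun i => ¬ d i = 1) = Finset.univ.filter fun i => d i = 2 := by
    ext i
    rcases hd.1 i with h | h <;> simp [h]
  rw [h2, hd.2, Finset.card_univ, Fintype.card_fin] at h
  omega

lemma exists_half_degree (hd : IsOneTwoDegrees p d) (hev : Even (∑ i, d i)) :
    ∃ m : ℕ, ∑ i, d i = 2 * m ∧ m ≤ N := by
  obtain ⟨m, hm⟩ := hev
  refine ⟨m, by omega, ?_⟩
  have : ∑ i, d i ≤ ∑ _i : Fin N, 2 := Finset.sum_le_sum fun i _ => by
    rcases hd.1 i with h | h <;> omega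
  simp at this
  omega

/-- The ratio of the coefficients of the two eigenvectors at a vertex of degree one. -/
noncomputable def vRatio (β B : ℝ) : ℝ := √(aRatio β B * rRatio β B ^ 2)

lemma vRatio_nonneg (β B : ℝ) : 0 ≤ vRatio β B := Real.sqrt_nonneg _

lemma vRatio_eq {β : ℝ} (hβ : 0 < β) (B : ℝ) :
    √(AMinus β B) * lamMinus β B = √(APlus β B) * lamPlus β B * vRatio β B := by
  have h1 := lamPlus_pos β B
  have h2 := lamMinus_pos hβ B
  have h3 := Real.sqrt_pos.2 (APlus_pos β B)
  rw [vRatio, Real.sqrt_mul (aRatio_nonneg hβ B), Real.sqrt_sq (rRatio_pos hβ B).le, aRatio,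
    Real.sqrt_div (AMinus_nonneg hβ B), rRatio]
  field_simp

variable {β B : ℝ}

/-- The averaged partition function is comparable to the maximum of a product of two powers. -/
lemma cmExpect_bounds (hβ : 0 < β) (hd : IsOneTwoDegrees p d) {m n1 n2 : ℕ}
    (hm : ∑ i, d i = 2 * m) (h1 : n1 = N - ⌊p * (N : ℝ)⌋₊) (h2 : n2 = ⌊p * (N : ℝ)⌋₊) :
    (∀ x y : ℝ, x ^ 2 + y ^ 2 = 1 →
      1 / (2 * (2 * m + 1) ^ 2) * ((√(APlus β B) * lamPlus β B) ^ n1 * lamPlus β B ^ n2 *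
        ((x + vRatio β B * y) ^ n1 * (x ^ 2 + rRatio β B * y ^ 2) ^ n2))
      ≤ cmExpect d (partitionFunction β B)) ∧
    (∀ R : ℝ, (∀ x y : ℝ, 0 ≤ x → 0 ≤ y → x ^ 2 + y ^ 2 = 1 →
        (x + vRatio β B * y) ^ n1 * (x ^ 2 + rRatio β B * y ^ 2) ^ n2 ≤ R) →
      cmExpect d (partitionFunction β B)
        ≤ (2 * m + 1) * (m + 1) ^ 2 *
          ((√(APlus β B) * lamPlus β B) ^ n1 * lamPlus β B ^ n2 * R)) := by
  obtain ⟨f, hf, hu, hL⟩ := exists_colour_factors hβ B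
  have hl1 := lamPlus_pos β B
  have hl2 := lamMinus_pos hβ B
  have hA := Real.sqrt_pos.2 (APlus_pos β B)
  have key : ∀ x y : ℝ,
      (√(APlus β B) * lamPlus β B * x + √(AMinus β B) * lamMinus β B * y) ^ n1 *
        (lamPlus β B * x ^ 2 + lamMinus β B * y ^ 2) ^ n2
      = (√(APlus β B) * lamPlus β B) ^ n1 * lamPlus β B ^ n2 *
        ((x + vRatio β B * y) ^ n1 * (x ^ 2 + rRatio β B * y ^ 2) ^ n2) := by
    intro x y
    have e1 : √(APlus β B) * lamPlus β B * x + √(AMinus β B) * lamMinus β B * y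
        = √(APlus β B) * lamPlus β B * (x + vRatio β B * y) := by
      rw [vRatio_eq hβ]
      ring
    have e2 : lamPlus β B * x ^ 2 + lamMinus β B * y ^ 2
        = lamPlus β B * (x ^ 2 + rRatio β B * y ^ 2) := by
      rw [rRatio]
      field_simp
    rw [e1, e2, mul_pow, mul_pow (lamPlus β B)]
    ring
  have hun : ∀ b : Bool, 0 ≤ (fun b : Bool => if b then √(APlus β B) * lamPlus β B
      else √(AMinus β B) * lamMinus β B) b := by
    rintro (_ | _) <;> simp <;> positivity
  have hLn : ∀ b : Bool, 0 ≤ (fun b : Bool => if b then lamPlus β B else lamMinus β B) b := by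
    rintro (_ | _) <;> simp <;> positivity
  have hc1 := (card_degree_one hd).trans h1.symm
  have hc2 := hd.2.trans h2.symm
  rw [cmExpect_partitionFunction d hd.1 hm β B f _ _ hf hu hL]
  constructor
  · intro x y hxy
    rw [← key]
    exact le_sum_pairWeight d hd.1 hm hun hLn hc1 hc2 hxy
  · intro R hR
    refine sum_pairWeight_le d hd.1 hm hun hLn hc1 hc2 fun x y hx hy hxy => ?_
    simp only [if_true, Bool.false_eq_true, if_false]
    rw [key]
    have := hR x y hx hy hxy
    gcongr

lemma natFloor_mul_bounds (hp0 : 0 < p) (N : ℕ) :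
    0 ≤ p * N - ⌊p * (N : ℝ)⌋₊ ∧ p * N - ⌊p * (N : ℝ)⌋₊ ≤ 1 := by
  have h1 := Nat.floor_le (show 0 ≤ p * (N : ℝ) by positivity)
  have h2 := Nat.lt_floor_add_one (p * (N : ℝ))
  constructor <;> linarith

lemma natFloor_mul_lt (hp0 : 0 < p) (hp1 : p < 1) (hN : 0 < N) : ⌊p * (N : ℝ)⌋₊ < N := by
  have hN' : (0 : ℝ) < N := by exact_mod_cast hN
  rw [Nat.floor_lt (by positivity)]
  nlinarith

/-- With $\delta=pN-\lfloor pN\rfloor\in[0,1]$ the exponents are $(1-p)N+\delta$ and $pN-\delta$, so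
rounding costs a bounded amount. It must be bounded uniformly in the direction, whence the constants
in `v` and `r`; the polynomial prefactors give the logarithm. -/
lemma log_cmExpect_le (hp0 : 0 < p) (hp1 : p < 1) (hβ : 0 < β) (hN : 0 < N)
    (hd : IsOneTwoDegrees p d) (hev : Even (∑ i, d i)) {h : ℝ}
    (hub : ∀ x y : ℝ, 0 ≤ x → 0 ≤ y → x ^ 2 + y ^ 2 = 1 → 0 < x + vRatio β B * y →
      (1 - p) * Real.log (x + vRatio β B * y) + p * Real.log (x ^ 2 + rRatio β B * y ^ 2) ≤ h) :
    Real.log (cmExpect d (partitionFunction β B))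
      ≤ N * (Real.log (lamPlus β B) + (1 - p) / 2 * Real.log (APlus β B) + h)
        + (1 / 2 * |Real.log (APlus β B)| + 1 / 2 * Real.log (1 + vRatio β B ^ 2)
          - Real.log (rRatio β B)) + 3 * Real.log (2 * N + 1) := by
  obtain ⟨m, hm, hmN⟩ := exists_half_degree hd hev
  obtain ⟨n2, hn2⟩ : ∃ n2, n2 = ⌊p * (N : ℝ)⌋₊ := ⟨_, rfl⟩
  obtain ⟨n1, hn1⟩ : ∃ n1, n1 = N - ⌊p * (N : ℝ)⌋₊ := ⟨_, rfl⟩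
  have hlt := natFloor_mul_lt hp0 hp1 hN
  have hfl := natFloor_mul_bounds hp0 N
  rw [← hn2] at hlt hfl
  have hn1N : (n1 : ℝ) = N - n2 := by rw [hn1, ← hn2, Nat.cast_sub hlt.le]
  obtain ⟨hlow, hupp⟩ := cmExpect_bounds (B := B) hβ hd hm hn1 hn2
  have hl1 := lamPlus_pos β B
  have hA := APlus_pos β B
  have hA' := Real.sqrt_pos.2 hA
  have hr0 := rRatio_pos hβ B
  have hr1 := (rRatio_lt_one β B).le
  have hv0 := vRatio_nonneg β B
  set v := vRatio β B
  set r := rRatio β B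
  obtain ⟨δ, hδ⟩ : ∃ δ, p * N - n2 = δ := ⟨_, rfl⟩
  rw [hδ] at hfl
  have hpos : 0 < cmExpect d (partitionFunction β B) := by
    have := hlow 1 0 (by norm_num)
    refine lt_of_lt_of_le ?_ this
    simp only [mul_zero, add_zero, one_pow]
    positivity
  have hR := hupp (Real.exp (N * h + (1 / 2 * Real.log (1 + v ^ 2) - Real.log r))) (by
    intro x y hx hy hxy
    -- A direction with $x+vy=0$ is not covered by `hub`, but there the product is zero, as `n1` is
    -- positive.
    rcases (show 0 ≤ x + v * y by positivity).eq_or_lt with h0 | h0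
    · rw [← h0, zero_pow (by omega), zero_mul]
      positivity
    · have hxy2 : r ≤ x ^ 2 + r * y ^ 2 := by nlinarith [sq_nonneg x]
      have hx2 : 0 < x ^ 2 + r * y ^ 2 := lt_of_lt_of_le hr0 hxy2
      rw [← Real.exp_log (show 0 < (x + v * y) ^ n1 * (x ^ 2 + r * y ^ 2) ^ n2 by positivity)]
      apply Real.exp_le_exp.2
      rw [Real.log_mul (by positivity) (by positivity), Real.log_pow, Real.log_pow]
      have e1 := hub x y hx hy hxy h0
      have e2 : Real.log r ≤ Real.log (x ^ 2 + r * y ^ 2) := Real.log_le_log hr0 hxy2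
      -- Cauchy–Schwarz: $(x+vy)^2\le1+v^2$ on the unit circle.
      have e3 : Real.log (x + v * y) ≤ 1 / 2 * Real.log (1 + v ^ 2) := by
        have : Real.log ((x + v * y) ^ 2) ≤ Real.log (1 + v ^ 2) :=
          Real.log_le_log (by positivity) (by nlinarith [sq_nonneg (v * x - y)])
        rw [Real.log_pow] at this
        push_cast at this
        linarith
      have e4 : 0 ≤ Real.log (1 + v ^ 2) := Real.log_nonneg (by nlinarith [sq_nonneg v])
      have e5 : Real.log r ≤ 0 := Real.log_nonpos hr0.le hr1
      have hNn : (n1 : ℝ) = (1 - p) * N + δ := by rw [hn1N]; linarith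
      have hn2' : (n2 : ℝ) = p * N - δ := by linarith
      rw [hNn, hn2']
      have hN0 : (0 : ℝ) ≤ N := by positivity
      nlinarith [mul_le_mul_of_nonneg_left e1 hN0, mul_le_mul_of_nonneg_left e2 hfl.1,
        mul_le_mul_of_nonneg_left e3 hfl.1, mul_le_mul_of_nonneg_right hfl.2 e4,
        mul_le_mul_of_nonneg_right hfl.2 (neg_nonneg.2 e5)])
  refine (Real.log_le_log hpos hR).trans ?_
  have hm0 : (0 : ℝ) ≤ m := by positivity
  have hmN' : (m : ℝ) ≤ N := by exact_mod_cast hmN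
  have hpoly : Real.log ((2 * m + 1) * (m + 1) ^ 2) ≤ 3 * Real.log (2 * N + 1) := by
    rw [show 3 * Real.log (2 * (N : ℝ) + 1) = Real.log ((2 * (N : ℝ) + 1) ^ 3) by
      rw [Real.log_pow]; norm_num]
    refine Real.log_le_log (by positivity) ?_
    calc (2 * (m : ℝ) + 1) * (m + 1) ^ 2 ≤ (2 * N + 1) * (2 * N + 1) ^ 2 := by
          gcongr
          linarith
      _ = _ := by ring
  have hhalf : Real.log (√(APlus β B)) = 1 / 2 * Real.log (APlus β B) := by
    rw [Real.log_sqrt hA.le]; ring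
  rw [Real.log_mul (by positivity) (by positivity)]
  refine (add_le_add hpoly le_rfl).trans ?_
  rw [Real.log_mul (by positivity) (by positivity),
    Real.log_mul (by positivity) (by positivity), Real.log_exp, Real.log_pow, Real.log_pow,
    Real.log_mul hA'.ne' hl1.ne', hhalf]
  have hn1' : (n1 : ℝ) = (1 - p) * N + δ := by rw [hn1N]; linarith
  have hn2' : (n2 : ℝ) = p * N - δ := by linarith
  rw [hn1', hn2']
  have hab : δ * Real.log (APlus β B) ≤ |Real.log (APlus β B)| := by
    calc _ ≤ δ * |Real.log (APlus β B)| := mul_le_mul_of_nonneg_left (le_abs_self _) hfl.1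
      _ ≤ 1 * |Real.log (APlus β B)| := mul_le_mul_of_nonneg_right hfl.2 (abs_nonneg _)
      _ = _ := one_mul _
  nlinarith

lemma le_log_cmExpect (hp0 : 0 < p) (hp1 : p < 1) (hβ : 0 < β) (hN : 0 < N)
    (hd : IsOneTwoDegrees p d) (hev : Even (∑ i, d i)) {h x y : ℝ}
    (hxy : x ^ 2 + y ^ 2 = 1) (hxv : 0 < x + vRatio β B * y)
    (hat : h ≤ (1 - p) * Real.log (x + vRatio β B * y)
      + p * Real.log (x ^ 2 + rRatio β B * y ^ 2)) :
    N * (Real.log (lamPlus β B) + (1 - p) / 2 * Real.log (APlus β B) + h)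
      - (1 / 2 * |Real.log (APlus β B)| + |Real.log (x + vRatio β B * y)
        - Real.log (x ^ 2 + rRatio β B * y ^ 2)| + Real.log 2) - 3 * Real.log (2 * N + 1)
      ≤ Real.log (cmExpect d (partitionFunction β B)) := by
  obtain ⟨m, hm, hmN⟩ := exists_half_degree hd hev
  obtain ⟨n2, hn2⟩ : ∃ n2, n2 = ⌊p * (N : ℝ)⌋₊ := ⟨_, rfl⟩
  obtain ⟨n1, hn1⟩ : ∃ n1, n1 = N - ⌊p * (N : ℝ)⌋₊ := ⟨_, rfl⟩
  have hlt := natFloor_mul_lt hp0 hp1 hN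
  have hfl := natFloor_mul_bounds hp0 N
  rw [← hn2] at hlt hfl
  have hn1N : (n1 : ℝ) = N - n2 := by rw [hn1, ← hn2, Nat.cast_sub hlt.le]
  have hlow := (cmExpect_bounds (B := B) hβ hd hm hn1 hn2).1 x y hxy
  have hl1 := lamPlus_pos β B
  have hA := APlus_pos β B
  have hA' := Real.sqrt_pos.2 hA
  have hr0 := rRatio_pos hβ B
  have hr1 := (rRatio_lt_one β B).le
  set v := vRatio β B
  set r := rRatio β B
  obtain ⟨δ, hδ⟩ : ∃ δ, p * N - n2 = δ := ⟨_, rfl⟩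
  rw [hδ] at hfl
  have hx2 : 0 < x ^ 2 + r * y ^ 2 := by nlinarith [sq_nonneg x]
  refine le_trans ?_ (Real.log_le_log (by positivity) hlow)
  have hm0 : (0 : ℝ) ≤ m := by positivity
  have hmN' : (m : ℝ) ≤ N := by exact_mod_cast hmN
  have hpoly : Real.log (2 * m + 1) ≤ Real.log (2 * N + 1) :=
    Real.log_le_log (by positivity) (by linarith)
  have hpoly0 : 0 ≤ Real.log (2 * (N : ℝ) + 1) := Real.log_nonneg (by
    have : (0 : ℝ) ≤ N := by positivity
    linarith)
  have hhalf : Real.log (√(APlus β B)) = 1 / 2 * Real.log (APlus β B) := by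
    rw [Real.log_sqrt hA.le]; ring
  rw [Real.log_mul (by positivity) (by positivity), Real.log_mul (by positivity) (by positivity),
    Real.log_mul (by positivity) (by positivity), Real.log_mul (by positivity) (by positivity),
    Real.log_div one_ne_zero (by positivity), Real.log_one, Real.log_mul two_ne_zero (by positivity),
    Real.log_pow, Real.log_pow, Real.log_pow, Real.log_pow, Real.log_pow,
    Real.log_mul hA'.ne' hl1.ne', hhalf]
  have hn1' : (n1 : ℝ) = (1 - p) * N + δ := by rw [hn1N]; linarith
  have hn2' : (n2 : ℝ) = p * N - δ := by linarith
  rw [hn1', hn2']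
  have hab : ∀ w : ℝ, -|w| ≤ δ * w := fun w => by
    have h1 : |δ * w| ≤ |w| := by
      rw [abs_mul, abs_of_nonneg hfl.1]
      calc _ ≤ 1 * |w| := mul_le_mul_of_nonneg_right hfl.2 (abs_nonneg _)
        _ = _ := one_mul _
    linarith [neg_abs_le (δ * w)]
  have hab1 := hab (Real.log (APlus β B))
  have hab2 := hab (Real.log (x + v * y) - Real.log (x ^ 2 + r * y ^ 2))
  have hN0 : (0 : ℝ) ≤ N := by positivity
  have hath := mul_le_mul_of_nonneg_left hat hN0
  push_cast
  nlinarith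

end Limit

/-- The annealed pressure converges to the maximum of an explicit function on a quarter circle. -/
lemma tendsto_annealedPressure {p : ℝ} (hp0 : 0 < p) (hp1 : p < 1)
    (d : (N : ℕ) → Fin N → ℕ) (hd : ∀ N, IsOneTwoDegrees p (d N)) {β B : ℝ} (hβ : 0 < β) {h : ℝ}
    (hub : ∀ x y : ℝ, 0 ≤ x → 0 ≤ y → x ^ 2 + y ^ 2 = 1 → 0 < x + vRatio β B * y →
      (1 - p) * Real.log (x + vRatio β B * y) + p * Real.log (x ^ 2 + rRatio β B * y ^ 2) ≤ h)
    (hat : ∃ x y : ℝ, x ^ 2 + y ^ 2 = 1 ∧ 0 < x + vRatio β B * y ∧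
      h ≤ (1 - p) * Real.log (x + vRatio β B * y)
        + p * Real.log (x ^ 2 + rRatio β B * y ^ 2)) :
    Tendsto (fun N => annealedPressure (d N) β B) (evenSizes d)
      (𝓝 (Real.log (lamPlus β B) + (1 - p) / 2 * Real.log (APlus β B) + h)) := by
  obtain ⟨x, y, hxy, hxv, hat⟩ := hat
  have hlim : ∀ C K k : ℝ, Tendsto (fun N : ℕ => C + K / N + k * (Real.log (2 * (N : ℝ) + 1) / N))
      (evenSizes d) (𝓝 C) := by
    intro C K k
    have h1 := ((tendsto_const_nhds (x := C)).add (tendsto_const_div_atTop_nhds_zero_nat K)).add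
      (tendsto_log_two_mul_add_one_div.const_mul k)
    simp only [mul_zero, add_zero] at h1
    exact h1.mono_left inf_le_left
  have hev : ∀ᶠ N in evenSizes d, 0 < N ∧ Even (∑ i, d N i) :=
    ((eventually_gt_atTop 0).filter_mono inf_le_left).and
      (mem_inf_of_right (mem_principal_self _))
  refine tendsto_of_tendsto_of_tendsto_of_le_of_le'
    (hlim _ (-(1 / 2 * |Real.log (APlus β B)| + |Real.log (x + vRatio β B * y)
        - Real.log (x ^ 2 + rRatio β B * y ^ 2)| + Real.log 2)) (-3))
    (hlim _ (1 / 2 * |Real.log (APlus β B)| + 1 / 2 * Real.log (1 + vRatio β B ^ 2)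
          - Real.log (rRatio β B)) 3) ?_ ?_
  · filter_upwards [hev] with N hN
    have hN' : (0 : ℝ) < N := by exact_mod_cast hN.1
    have := le_log_cmExpect (B := B) hp0 hp1 hβ hN.1 (hd N) hN.2 hxy hxv hat
    rw [annealedPressure, one_div_mul_eq_div (N : ℝ), le_div_iff₀ hN']
    refine le_trans (le_of_eq ?_) this
    field_simp
    ring
  · filter_upwards [hev] with N hN
    have hN' : (0 : ℝ) < N := by exact_mod_cast hN.1
    have := log_cmExpect_le (B := B) hp0 hp1 hβ hN.1 (hd N) hN.2 hub
    rw [annealedPressure, one_div_mul_eq_div (N : ℝ), div_le_iff₀ hN']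
    refine le_trans this (le_of_eq ?_)
    field_simp

/-! ### Gibbs' inequality for two terms -/

/-- This is $\log u\le u-1$ at $u=x/(ac)$, where $c$ is a free normalisation. The hypothesis `hax`
excludes the case in which $a\log x$ should be $-\infty$ but `Real.log 0 = 0`. -/
lemma mul_log_add_negMulLog_le {a x c : ℝ} (ha : 0 ≤ a) (hx : 0 ≤ x) (hax : 0 < a → 0 < x)
    (hc : 0 < c) : a * Real.log x + negMulLog a ≤ a * Real.log c + x / c - a := by
  rcases ha.eq_or_lt with rfl | ha
  · simp; positivity
  · have h0 := hax ha
    have h := Real.log_le_sub_one_of_pos (show 0 < x / (a * c) by positivity)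
    rw [Real.log_div h0.ne' (by positivity), Real.log_mul ha.ne' hc.ne'] at h
    have h2 := mul_le_mul_of_nonneg_left h ha.le
    have h3 : a * (x / (a * c) - 1) = x / c - a := by field_simp
    rw [h3] at h2
    rw [negMulLog]
    linarith

lemma mul_log_add_negMulLog_lt {a x c : ℝ} (ha : 0 ≤ a) (hx : 0 ≤ x) (hax : 0 < a → 0 < x)
    (hc : 0 < c) (hne : x ≠ a * c) :
    a * Real.log x + negMulLog a < a * Real.log c + x / c - a := by
  rcases ha.eq_or_lt with rfl | ha
  · have : 0 < x := lt_of_le_of_ne hx (by simpa using hne.symm)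
    simp; positivity
  · have h0 := hax ha
    have h := Real.log_lt_sub_one_of_pos (show 0 < x / (a * c) by positivity)
      (fun h1 => hne (by rwa [div_eq_one_iff_eq (by positivity)] at h1))
    rw [Real.log_div h0.ne' (by positivity), Real.log_mul ha.ne' hc.ne'] at h
    have h2 := mul_lt_mul_of_pos_left h ha
    have h3 : a * (x / (a * c) - 1) = x / c - a := by field_simp
    rw [h3] at h2
    rw [negMulLog]
    linarith

/-- The (unnormalised) entropy of a splitting. -/
noncomputable def splitEntropy (a b : ℝ) : ℝ := negMulLog a + negMulLog b - negMulLog (a + b)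

/-- Add the one-term inequalities with the common normalisation $c=(x+y)/(a+b)$; the linear terms
cancel. -/
lemma splitEntropy_add_le {a b x y : ℝ} (ha : 0 ≤ a) (hb : 0 ≤ b) (hx : 0 ≤ x) (hy : 0 ≤ y)
    (hax : 0 < a → 0 < x) (hby : 0 < b → 0 < y) :
    a * Real.log x + b * Real.log y + splitEntropy a b ≤ (a + b) * Real.log (x + y) := by
  rcases (add_nonneg ha hb).eq_or_lt with h0 | h0
  · obtain rfl : a = 0 := by linarith
    obtain rfl : b = 0 := by linarith
    simp [splitEntropy]
  · have hxy : 0 < x + y := by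
      rcases ha.eq_or_lt with rfl | h
      · have := hby (by linarith)
        linarith
      · have := hax h
        linarith
    have hc : 0 < (x + y) / (a + b) := by positivity
    have h1 := mul_log_add_negMulLog_le ha hx hax hc
    have h2 := mul_log_add_negMulLog_le hb hy hby hc
    have h3 : x / ((x + y) / (a + b)) + y / ((x + y) / (a + b)) = a + b := by field_simp
    rw [Real.log_div hxy.ne' h0.ne'] at h1 h2
    rw [splitEntropy, negMulLog.eq_1 (a + b)]
    linarith

lemma splitEntropy_add_lt {a b x y : ℝ} (ha : 0 ≤ a) (hb : 0 ≤ b) (hx : 0 ≤ x) (hy : 0 ≤ y)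
    (hax : 0 < a → 0 < x) (hby : 0 < b → 0 < y) (hne : a * y ≠ b * x) :
    a * Real.log x + b * Real.log y + splitEntropy a b < (a + b) * Real.log (x + y) := by
  rcases (add_nonneg ha hb).eq_or_lt with h0 | h0
  · obtain rfl : a = 0 := by linarith
    obtain rfl : b = 0 := by linarith
    simp at hne
  · have hxy : 0 < x + y := by
      rcases ha.eq_or_lt with rfl | h
      · have := hby (by linarith)
        linarith
      · have := hax h
        linarith
    have hc : 0 < (x + y) / (a + b) := by positivity
    have h1 := mul_log_add_negMulLog_lt ha hx hax hc (fun h => hne (by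
      field_simp at h
      linarith))
    have h2 := mul_log_add_negMulLog_le hb hy hby hc
    have h3 : x / ((x + y) / (a + b)) + y / ((x + y) / (a + b)) = a + b := by field_simp
    rw [Real.log_div hxy.ne' h0.ne'] at h1 h2
    rw [splitEntropy, negMulLog.eq_1 (a + b)]
    linarith

/-- The equality case of Gibbs' inequality, proportional pairs. -/
lemma splitEntropy_smul (k x y : ℝ) :
    k * x * Real.log x + k * y * Real.log y + splitEntropy (k * x) (k * y)
      = (k * x + k * y) * Real.log (x + y) := by
  rw [splitEntropy, ← mul_add, Real.negMulLog_mul, Real.negMulLog_mul, Real.negMulLog_mul]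
  simp only [negMulLog]
  ring

lemma splitEntropy_homogeneous (k x y : ℝ) :
    splitEntropy (k * x) (k * y) = k * splitEntropy x y := by
  rw [splitEntropy, splitEntropy, ← mul_add, Real.negMulLog_mul, Real.negMulLog_mul,
    Real.negMulLog_mul]
  simp only [negMulLog]
  ring

/-- Test both pairs in Gibbs' inequality against their sum. Together with homogeneity this is joint
concavity. -/
lemma splitEntropy_superadditive {a b a' b' : ℝ} (ha : 0 ≤ a) (hb : 0 ≤ b) (ha' : 0 ≤ a')
    (hb' : 0 ≤ b') : splitEntropy a b + splitEntropy a' b' ≤ splitEntropy (a + a') (b + b') := by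
  have h1 := splitEntropy_add_le ha hb (add_nonneg ha ha') (add_nonneg hb hb')
    (fun h => by linarith) (fun h => by linarith)
  have h2 := splitEntropy_add_le ha' hb' (add_nonneg ha ha') (add_nonneg hb hb')
    (fun h => by linarith) (fun h => by linarith)
  have h3 := splitEntropy_smul 1 (a + a') (b + b')
  simp only [one_mul] at h3
  linarith

lemma splitEntropy_superadditive_lt {a b a' b' : ℝ} (ha : 0 ≤ a) (hb : 0 ≤ b) (ha' : 0 ≤ a')
    (hb' : 0 ≤ b') (hne : a * b' ≠ b * a') :
    splitEntropy a b + splitEntropy a' b' < splitEntropy (a + a') (b + b') := by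
  have h1 := splitEntropy_add_lt ha hb (add_nonneg ha ha') (add_nonneg hb hb')
    (fun h => by linarith) (fun h => by linarith) (fun h => hne (by linarith))
  have h2 := splitEntropy_add_le ha' hb' (add_nonneg ha ha') (add_nonneg hb hb')
    (fun h => by linarith) (fun h => by linarith)
  have h3 := splitEntropy_smul 1 (a + a') (b + b')
  simp only [one_mul] at h3
  linarith

/-! ### The entropy part of `H` -/

/-- The part of `H` that depends on neither `β` nor `B`. -/
noncomputable def entropy (p : ℝ) (z : ℝ × ℝ) : ℝ :=
  2 * splitEntropy z.1 ((1 - p) / 2 - z.1) + splitEntropy z.2 (p - z.2)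
    - splitEntropy (z.1 + z.2) ((1 + p) / 2 - (z.1 + z.2))

lemma H_eq {p : ℝ} (β B : ℝ) (z : ℝ × ℝ) :
    H p β B z = entropy p z + z.1 * Real.log (aRatio β B * rRatio β B ^ 2)
      + z.2 * Real.log (rRatio β B) := by
  simp only [H, entropy, splitEntropy, add_sub_cancel, negMulLog]
  ring_nf

/-- The definition contains a split entropy with a minus sign, which hides concavity. Grouping by
colour instead of by degree leaves only concave terms and constants. -/
lemma entropy_eq (p : ℝ) (z : ℝ × ℝ) :
    entropy p z = splitEntropy z.1 z.2 + splitEntropy ((1 - p) / 2 - z.1) (p - z.2)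
      + negMulLog z.1 + negMulLog ((1 - p) / 2 - z.1)
      - 2 * negMulLog ((1 - p) / 2) - negMulLog p + negMulLog ((1 + p) / 2) := by
  simp only [entropy, splitEntropy, add_sub_cancel]
  rw [show (1 - p) / 2 - z.1 + (p - z.2) = (1 + p) / 2 - (z.1 + z.2) by ring]
  ring

lemma continuous_entropy (p : ℝ) : Continuous (entropy p) := by
  unfold entropy splitEntropy
  have := Real.continuous_negMulLog
  fun_prop

lemma entropy_zero (p : ℝ) : entropy p (0, 0) = 0 := by
  simp [entropy, splitEntropy]

lemma entropy_corner (p : ℝ) : entropy p ((1 - p) / 2, p) = 0 := by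
  have : (1 + p) / 2 - ((1 - p) / 2 + p) = 0 := by ring
  simp [entropy, splitEntropy, this]

lemma mem_rect {p : ℝ} {z : ℝ × ℝ} :
    z ∈ rect p ↔ (0 ≤ z.1 ∧ z.1 ≤ (1 - p) / 2) ∧ 0 ≤ z.2 ∧ z.2 ≤ p := by
  simp only [rect, Set.mem_prod, Set.mem_Icc]

lemma convex_rect (p : ℝ) : Convex ℝ (rect p) := (convex_Icc _ _).prod (convex_Icc _ _)

lemma isCompact_rect (p : ℝ) : IsCompact (rect p) := isCompact_Icc.prod isCompact_Icc

lemma strictConcaveOn_entropy {p : ℝ} (hp1 : p < 1) :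
    StrictConcaveOn ℝ (rect p) (entropy p) := by
  refine ⟨convex_rect p, ?_⟩
  rintro ⟨s, t⟩ hz ⟨s', t'⟩ hz' hne a b ha hb hab
  rw [mem_rect] at hz hz'
  obtain ⟨⟨hs0, hs1⟩, ht0, ht1⟩ := hz
  obtain ⟨⟨hs0', hs1'⟩, ht0', ht1'⟩ := hz'
  simp only at hs0 hs1 ht0 ht1 hs0' hs1' ht0' ht1'
  simp only [entropy_eq, smul_eq_mul, Prod.smul_mk, Prod.mk_add_mk]
  obtain ⟨q, hq⟩ : ∃ q, (1 - p) / 2 = q := ⟨_, rfl⟩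
  have hq0 : 0 < q := by linarith
  rw [hq] at hs1 hs1' ⊢
  have hs2 : 0 ≤ q - s := by linarith
  have hs2' : 0 ≤ q - s' := by linarith
  have ht2 : 0 ≤ p - t := by linarith
  have ht2' : 0 ≤ p - t' := by linarith
  have e1 : q - (a * s + b * s') = a * (q - s) + b * (q - s') := by
    linear_combination (-q) * hab
  have e2 : p - (a * t + b * t') = a * (p - t) + b * (p - t') := by
    linear_combination (-p) * hab
  rw [e1, e2]
  have f1 := splitEntropy_superadditive (mul_nonneg ha.le hs0) (mul_nonneg ha.le ht0)
    (mul_nonneg hb.le hs0') (mul_nonneg hb.le ht0')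
  have f2 := splitEntropy_superadditive (mul_nonneg ha.le hs2) (mul_nonneg ha.le ht2)
    (mul_nonneg hb.le hs2') (mul_nonneg hb.le ht2')
  have f3 := Real.concaveOn_negMulLog.2 (Set.mem_Ici.2 hs0) (Set.mem_Ici.2 hs0') ha.le hb.le hab
  have f4 := Real.concaveOn_negMulLog.2 (Set.mem_Ici.2 hs2) (Set.mem_Ici.2 hs2') ha.le hb.le hab
  simp only [smul_eq_mul] at f3 f4
  -- If $s\ne s'$, strictness comes from `negMulLog`. If $s=s'$ and $t\ne t'$, it comes from a split
  -- entropy: two pairs with equal nonzero first entry are not proportional, and $s$ and $q-s$ are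
  -- not both zero.
  have hsum : splitEntropy (a * s) (a * t) + splitEntropy (b * s') (b * t')
      + (splitEntropy (a * (q - s)) (a * (p - t)) + splitEntropy (b * (q - s')) (b * (p - t')))
      + (a * negMulLog s + b * negMulLog s')
      < splitEntropy (a * s + b * s') (a * t + b * t')
        + splitEntropy (a * (q - s) + b * (q - s')) (a * (p - t) + b * (p - t'))
        + negMulLog (a * s + b * s') := by
    by_cases hss : s = s'
    · subst hss
      have htt : t ≠ t' := fun h => hne (by rw [h])
      rcases hs0.eq_or_lt with h0 | h0
      · have f2' := splitEntropy_superadditive_lt (mul_nonneg ha.le hs2) (mul_nonneg ha.le ht2)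
          (mul_nonneg hb.le hs2') (mul_nonneg hb.le ht2') (fun h => htt (by
            rw [← h0] at h
            have h5 : (a * b * q) * t = (a * b * q) * t' := by linarith
            exact mul_left_cancel₀ (by positivity) h5))
        linarith
      · have f1' := splitEntropy_superadditive_lt (mul_nonneg ha.le hs0) (mul_nonneg ha.le ht0)
          (mul_nonneg hb.le hs0') (mul_nonneg hb.le ht0') (fun h => htt (by
            have h5 : (a * b * s) * t = (a * b * s) * t' := by linarith
            exact mul_left_cancel₀ (by positivity) h5))
        linarith
    · have f3' := Real.strictConcaveOn_negMulLog.2 (Set.mem_Ici.2 hs0) (Set.mem_Ici.2 hs0') hss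
        ha hb hab
      simp only [smul_eq_mul] at f3'
      linarith
  simp only [splitEntropy_homogeneous] at hsum
  have hb' : b = 1 - a := by linarith
  subst hb'
  linarith

lemma strictConcaveOn_H {p : ℝ} (hp1 : p < 1) (β B : ℝ) :
    StrictConcaveOn ℝ (rect p) (H p β B) := by
  have h := strictConcaveOn_entropy hp1
  refine ⟨h.1, fun z hz z' hz' hne a b ha hb hab => ?_⟩
  have := h.2 hz hz' hne ha hb hab
  simp only [H_eq, smul_eq_mul, Prod.fst_add, Prod.snd_add, Prod.smul_fst, Prod.smul_snd] at this ⊢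
  linarith

lemma continuous_H (p β B : ℝ) : Continuous (H p β B) := by
  have : H p β B = fun z => entropy p z + z.1 * Real.log (aRatio β B * rRatio β B ^ 2)
      + z.2 * Real.log (rRatio β B) := funext fun z => H_eq β B z
  rw [this]
  have := continuous_entropy p
  fun_prop

/-! ### Duality between `H` and the one-parameter problem -/

section Duality

variable {p v r : ℝ}

/-- Gibbs' inequality for $(s,\frac{1-p}2-s)$ against $(vy,x)$, used twice, and for $(t,p-t)$
against $(ry^2,x^2)$. The split entropy of $s+t$ enters negatively and therefore needs equality,
which dictates the choice of $x$ and $y$. -/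
lemma entropy_add_le (hp0 : 0 < p) (hp1 : p < 1) (hv : 0 < v) (hr : 0 < r) {z : ℝ × ℝ}
    (hz : z ∈ rect p) {x y : ℝ} (hx : 0 ≤ x) (hy : 0 ≤ y)
    (hx2 : x ^ 2 = 1 - (z.1 + z.2) / ((1 + p) / 2)) (hy2 : y ^ 2 = (z.1 + z.2) / ((1 + p) / 2)) :
    entropy p z + z.1 * Real.log (v ^ 2) + z.2 * Real.log r
      ≤ (1 - p) * Real.log (x + v * y) + p * Real.log (x ^ 2 + r * y ^ 2) := by
  obtain ⟨s, t⟩ := z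
  rw [mem_rect] at hz
  simp only at hz hx2 hy2 ⊢
  obtain ⟨⟨hs0, hs1⟩, ht0, ht1⟩ := hz
  obtain ⟨k, hk⟩ : ∃ k, (1 + p) / 2 = k := ⟨_, rfl⟩
  have hk0 : 0 < k := by linarith
  rw [hk] at hx2 hy2
  have hkq : (1 - p) / 2 + p = k := by linarith
  have hypos : 0 < s + t → 0 < y := fun h => by
    have : 0 < y ^ 2 := by rw [hy2]; positivity
    exact lt_of_le_of_ne hy fun h => by
      rw [← h] at this
      norm_num at this
  have hxpos : s + t < k → 0 < x := fun h => by
    have : 0 < x ^ 2 := by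
      rw [hx2, sub_pos, div_lt_one hk0]
      exact h
    exact lt_of_le_of_ne hx fun h => by
      rw [← h] at this
      norm_num at this
  have g1 := splitEntropy_add_le hs0 (sub_nonneg.2 hs1) (mul_nonneg hv.le hy) hx
    (fun h => mul_pos hv (hypos (by linarith))) (fun h => hxpos (by linarith))
  have g2 := splitEntropy_add_le ht0 (sub_nonneg.2 ht1) (mul_nonneg hr.le (sq_nonneg y))
    (sq_nonneg x)
    (fun h => mul_pos hr (pow_pos (hypos (by linarith)) 2))
    (fun h => pow_pos (hxpos (by linarith)) 2)
  have g3 := splitEntropy_smul k (y ^ 2) (x ^ 2)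
  have e1 : k * y ^ 2 = s + t := by rw [hy2]; field_simp
  have e2 : k * x ^ 2 = k - (s + t) := by rw [hx2]; field_simp
  rw [e1, e2, hx2, hy2, add_sub_cancel, add_sub_cancel, Real.log_one, mul_zero, ← hx2, ← hy2] at g3
  rw [add_sub_cancel] at g1 g2
  have l1 : s * Real.log (v * y) = s * Real.log v + s * Real.log y := by
    rcases hs0.eq_or_lt with h | h
    · rw [← h]; simp
    · rw [Real.log_mul hv.ne' (hypos (by linarith)).ne']; ring
  have l2 : t * Real.log (r * y ^ 2) = t * Real.log r + t * Real.log (y ^ 2) := by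
    rcases ht0.eq_or_lt with h | h
    · rw [← h]; simp
    · rw [Real.log_mul hr.ne' (pow_pos (hypos (by linarith)) 2).ne']; ring
  rw [l1] at g1
  rw [l2] at g2
  rw [Real.log_pow] at g2 g3
  rw [Real.log_pow] at g2 g3
  rw [Real.log_pow]
  rw [entropy, hk]
  simp only
  rw [add_comm (v * y) x] at g1
  rw [add_comm (r * y ^ 2)] at g2
  push_cast at g1 g2 g3 ⊢
  linear_combination 2 * g1 + g2 - g3 - 2 * Real.log x * hk

/-- The point of the rectangle that is dual to the direction `(x, y)`. -/
noncomputable def dualPoint (p v r x y : ℝ) : ℝ × ℝ :=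
  ((1 - p) / 2 * (v * y / (x + v * y)), p * (r * y ^ 2 / (x ^ 2 + r * y ^ 2)))

lemma dualPoint_mem (hp0 : 0 < p) (hp1 : p < 1) (hv : 0 < v) (hr : 0 < r) {x y : ℝ}
    (hx : 0 ≤ x) (hy : 0 ≤ y) : dualPoint p v r x y ∈ rect p := by
  have h1 : v * y / (x + v * y) ≤ 1 := div_le_one_of_le₀ (by linarith) (by positivity)
  have h2 : r * y ^ 2 / (x ^ 2 + r * y ^ 2) ≤ 1 :=
    div_le_one_of_le₀ (by nlinarith [sq_nonneg x]) (by positivity)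
  have h3 : 0 < (1 - p) / 2 := by linarith
  rw [mem_rect, dualPoint]
  refine ⟨⟨by positivity, ?_⟩, by positivity, ?_⟩
  · exact mul_le_of_le_one_right h3.le h1
  · exact mul_le_of_le_one_right hp0.le h2

lemma dualPoint_mem_interior (hp0 : 0 < p) (hp1 : p < 1) (hv : 0 < v) (hr : 0 < r) {x y : ℝ}
    (hx : 0 < x) (hy : 0 < y) : dualPoint p v r x y ∈ interior (rect p) := by
  have h1 : v * y / (x + v * y) < 1 := by
    rw [div_lt_one (by positivity)]; linarith
  have h2 : r * y ^ 2 / (x ^ 2 + r * y ^ 2) < 1 := by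
    rw [div_lt_one (by positivity)]; linarith [pow_pos hx 2]
  have h3 : 0 < (1 - p) / 2 := by linarith
  rw [rect, interior_prod_eq, interior_Icc, interior_Icc, dualPoint]
  refine ⟨⟨by positivity, ?_⟩, by positivity, ?_⟩
  · exact mul_lt_of_lt_one_right h3 h1
  · exact mul_lt_of_lt_one_right hp0 h2

/-- Here the roles are exchanged: the dual point gives equality in the Gibbs inequalities for $s$
and $t$, and the inequality for $s+t$, which enters negatively, points the right way. It contributes
$\log(x^2+y^2)=0$. -/
lemma le_entropy_dualPoint (hp0 : 0 < p) (hp1 : p < 1) (hv : 0 < v) (hr : 0 < r) {x y : ℝ}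
    (hx : 0 ≤ x) (hy : 0 ≤ y) (hxy : x ^ 2 + y ^ 2 = 1) :
    (1 - p) * Real.log (x + v * y) + p * Real.log (x ^ 2 + r * y ^ 2)
      ≤ entropy p (dualPoint p v r x y) + (dualPoint p v r x y).1 * Real.log (v ^ 2)
        + (dualPoint p v r x y).2 * Real.log r := by
  have hmem := dualPoint_mem hp0 hp1 hv hr hx hy
  have hA : 0 < x + v * y := by
    rcases hx.eq_or_lt with h | h
    · have : y ≠ 0 := by rintro rfl; rw [← h] at hxy; norm_num at hxy
      have := lt_of_le_of_ne hy this.symm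
      positivity
    · positivity
  have hB : 0 < x ^ 2 + r * y ^ 2 := by
    rcases hx.eq_or_lt with h | h
    · have : y ≠ 0 := by rintro rfl; rw [← h] at hxy; norm_num at hxy
      have := lt_of_le_of_ne hy this.symm
      positivity
    · positivity
  obtain ⟨s, hs⟩ : ∃ s, (dualPoint p v r x y).1 = s := ⟨_, rfl⟩
  obtain ⟨t, ht⟩ : ∃ t, (dualPoint p v r x y).2 = t := ⟨_, rfl⟩
  rw [mem_rect] at hmem
  rw [entropy, hs, ht]
  rw [hs, ht] at hmem
  obtain ⟨⟨hs0, hs1⟩, ht0, ht1⟩ := hmem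
  obtain ⟨k, hk⟩ : ∃ k, (1 - p) / 2 / (x + v * y) = k := ⟨_, rfl⟩
  obtain ⟨k', hk'⟩ : ∃ k', p / (x ^ 2 + r * y ^ 2) = k' := ⟨_, rfl⟩
  have hq0 : 0 < (1 - p) / 2 := by linarith
  have hk0 : 0 ≤ k := by rw [← hk]; positivity
  have hk0' : 0 ≤ k' := by rw [← hk']; positivity
  have s1 : s = k * (v * y) := by rw [← hs, ← hk, dualPoint]; field_simp
  have s2 : (1 - p) / 2 - s = k * x := by rw [s1, ← hk]; field_simp; ring
  have t1 : t = k' * (r * y ^ 2) := by rw [← ht, ← hk', dualPoint]; field_simp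
  have t2 : p - t = k' * x ^ 2 := by rw [t1, ← hk']; field_simp; ring
  have g1 := splitEntropy_smul k (v * y) x
  have g2 := splitEntropy_smul k' (r * y ^ 2) (x ^ 2)
  rw [← s1, ← s2, add_sub_cancel] at g1
  rw [← t1, ← t2, add_sub_cancel] at g2
  have hst : (1 + p) / 2 - (s + t) = k * x + k' * x ^ 2 := by rw [← s2, ← t2]; ring
  have g3 := splitEntropy_add_le (add_nonneg hs0 ht0)
    (show 0 ≤ (1 + p) / 2 - (s + t) by rw [hst]; positivity) (sq_nonneg y) (sq_nonneg x)
    (fun h => by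
      have : y ≠ 0 := by rintro rfl; rw [s1, t1] at h; simp at h
      positivity)
    (fun h => by
      have : x ≠ 0 := by rintro rfl; rw [hst] at h; simp at h
      positivity)
  rw [add_comm (y ^ 2), hxy, Real.log_one, mul_zero] at g3
  have l1 : s * Real.log (v * y) = s * Real.log v + s * Real.log y := by
    rcases hy.eq_or_lt with h | h
    · rw [s1, ← h]; simp
    · rw [Real.log_mul hv.ne' h.ne']; ring
  have l2 : t * Real.log (r * y ^ 2) = t * Real.log r + t * Real.log (y ^ 2) := by
    rcases hy.eq_or_lt with h | h
    · rw [t1, ← h]; simp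
    · rw [Real.log_mul hr.ne' (pow_pos h 2).ne']; ring
  rw [l1] at g1
  rw [l2] at g2
  rw [Real.log_pow] at g2 g3
  rw [Real.log_pow] at g2 g3
  rw [Real.log_pow]
  rw [add_comm (v * y) x] at g1
  rw [add_comm (r * y ^ 2)] at g2
  push_cast at g1 g2 g3 ⊢
  linear_combination g3 - 2 * g1 - g2

/-- The one-parameter problem has a positive value in some interior direction. -/
lemma exists_direction_pos (hp0 : 0 < p) (hp1 : p < 1) (hv : 0 < v) (hr : 0 < r) :
    ∃ x y : ℝ, 0 < x ∧ 0 < y ∧ x ^ 2 + y ^ 2 = 1 ∧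
      0 < (1 - p) * Real.log (x + v * y) + p * Real.log (x ^ 2 + r * y ^ 2) := by
  obtain ⟨w, hw0, hw1, hw2⟩ : ∃ w : ℝ, 0 < w ∧ v * w ≤ 1 ∧ (1 + p) * w < (1 - p) * v := by
    -- In the direction $(1,w)/\sqrt{1+w^2}$ the gain is at least $(1-p)vw/2$, using $vw\le1$, and
    -- the loss from normalising is at most $(1+p)w^2/2$.
    refine ⟨min (1 / v) ((1 - p) * v / (2 * (1 + p))), ?_, ?_, ?_⟩
    · have : 0 < 1 - p := by linarith
      have : 0 < 1 + p := by linarith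
      positivity
    · calc _ ≤ v * (1 / v) := mul_le_mul_of_nonneg_left (min_le_left _ _) hv.le
        _ = 1 := by field_simp
    · have h1 : 0 < 1 - p := by linarith
      have h2 : 0 < 1 + p := by linarith
      calc _ ≤ (1 + p) * ((1 - p) * v / (2 * (1 + p))) :=
            mul_le_mul_of_nonneg_left (min_le_right _ _) h2.le
        _ = (1 - p) * v / 2 := by field_simp
        _ < _ := by have := mul_pos h1 hv; linarith
  obtain ⟨D, hD⟩ : ∃ D, √(1 + w ^ 2) = D := ⟨_, rfl⟩
  have hD2 : D ^ 2 = 1 + w ^ 2 := by rw [← hD, Real.sq_sqrt (by positivity)]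
  have hD0 : 0 < D := by rw [← hD]; exact Real.sqrt_pos.2 (by positivity)
  refine ⟨1 / D, w / D, by positivity, by positivity, ?_, ?_⟩
  · field_simp
    linarith
  · have e1 : 1 / D + v * (w / D) = (1 + v * w) / D := by field_simp
    have e2 : (1 / D) ^ 2 + r * (w / D) ^ 2 = (1 + r * w ^ 2) / D ^ 2 := by field_simp
    have hvw : 0 < v * w := by positivity
    rw [e1, e2, Real.log_div (by positivity) hD0.ne', Real.log_div (by positivity) (by positivity),
      Real.log_pow]
    have a1 : 0 ≤ Real.log (1 + r * w ^ 2) := Real.log_nonneg (by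
      have : 0 < r * w ^ 2 := by positivity
      linarith)
    have a2 : 2 * Real.log D ≤ w ^ 2 := by
      have : 2 * Real.log D = Real.log (D ^ 2) := by rw [Real.log_pow]; norm_num
      rw [this, hD2]
      have := Real.log_le_sub_one_of_pos (show 0 < 1 + w ^ 2 by positivity)
      linarith
    have a3 : v * w / 2 ≤ Real.log (1 + v * w) := by
      have h := Real.one_sub_inv_le_log_of_pos (show 0 < 1 + v * w by positivity)
      refine le_trans ?_ h
      rw [← one_div, le_sub_iff_add_le, ← le_sub_iff_add_le', div_le_iff₀ (by positivity)]
      nlinarith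
    have hp : 0 < 1 - p := by linarith
    have b1 := mul_le_mul_of_nonneg_left a3 hp.le
    have b2 := mul_nonneg hp0.le a1
    have b3 := mul_le_mul_of_nonneg_left a2 (show 0 ≤ 1 + p by linarith)
    have b4 := mul_lt_mul_of_pos_right hw2 hw0
    push_cast
    nlinarith

end Duality

/-! ### The maximum point -/

section MaxPoint

variable {p β B : ℝ}

lemma vRatio_sq (hβ : 0 < β) (B : ℝ) : vRatio β B ^ 2 = aRatio β B * rRatio β B ^ 2 :=
  Real.sq_sqrt (mul_nonneg (aRatio_nonneg hβ B) (sq_nonneg _))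

lemma vRatio_pos (hβ : 0 < β) (hB : B ≠ 0) : 0 < vRatio β B :=
  Real.sqrt_pos.2 (mul_pos (aRatio_pos hβ hB) (pow_pos (rRatio_pos hβ B) 2))

lemma zero_mem_rect (hp0 : 0 < p) (hp1 : p < 1) : ((0, 0) : ℝ × ℝ) ∈ rect p := by
  rw [mem_rect]
  exact ⟨⟨le_rfl, by simp only; linarith⟩, le_rfl, hp0.le⟩

lemma H_zero (p β B : ℝ) : H p β B (0, 0) = 0 := by
  rw [H_eq, entropy_zero]
  simp

lemma le_H_dualPoint (hp0 : 0 < p) (hp1 : p < 1) (hβ : 0 < β) (hB : B ≠ 0) {x y : ℝ}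
    (hx : 0 ≤ x) (hy : 0 ≤ y) (hxy : x ^ 2 + y ^ 2 = 1) :
    (1 - p) * Real.log (x + vRatio β B * y) + p * Real.log (x ^ 2 + rRatio β B * y ^ 2)
      ≤ H p β B (dualPoint p (vRatio β B) (rRatio β B) x y) := by
  rw [H_eq, ← vRatio_sq hβ]
  exact le_entropy_dualPoint hp0 hp1 (vRatio_pos hβ hB) (rRatio_pos hβ B) hx hy hxy

lemma exists_H_le (hp0 : 0 < p) (hp1 : p < 1) (hβ : 0 < β) (hB : B ≠ 0) {z : ℝ × ℝ}
    (hz : z ∈ rect p) :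
    ∃ x y : ℝ, 0 ≤ x ∧ 0 ≤ y ∧ x ^ 2 + y ^ 2 = 1 ∧
      x ^ 2 = 1 - (z.1 + z.2) / ((1 + p) / 2) ∧ y ^ 2 = (z.1 + z.2) / ((1 + p) / 2) ∧
      H p β B z ≤ (1 - p) * Real.log (x + vRatio β B * y)
        + p * Real.log (x ^ 2 + rRatio β B * y ^ 2) := by
  have hz' := mem_rect.1 hz
  obtain ⟨⟨hs0, hs1⟩, ht0, ht1⟩ := hz'
  have hk : 0 < (1 + p) / 2 := by linarith
  have h1 : 0 ≤ (z.1 + z.2) / ((1 + p) / 2) := div_nonneg (by linarith) hk.le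
  have h2 : 0 ≤ 1 - (z.1 + z.2) / ((1 + p) / 2) := by
    rw [sub_nonneg, div_le_one hk]
    linarith
  have e1 := Real.sq_sqrt h2
  have e2 := Real.sq_sqrt h1
  refine ⟨_, _, Real.sqrt_nonneg _, Real.sqrt_nonneg _, ?_, e1, e2, ?_⟩
  · rw [e1, e2]; ring
  · rw [H_eq, ← vRatio_sq hβ]
    exact entropy_add_le hp0 hp1 (vRatio_pos hβ hB) (rRatio_pos hβ B) hz (Real.sqrt_nonneg _)
      (Real.sqrt_nonneg _) e1 e2

lemma exists_H_pos (hp0 : 0 < p) (hp1 : p < 1) (hβ : 0 < β) (hB : B ≠ 0) :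
    ∃ z ∈ rect p, 0 < H p β B z := by
  have hv := vRatio_pos hβ hB
  have hr := rRatio_pos hβ B
  obtain ⟨x, y, hx, hy, hxy, hpos⟩ := exists_direction_pos hp0 hp1 hv hr
  exact ⟨_, dualPoint_mem hp0 hp1 hv hr hx.le hy.le,
    hpos.trans_le (le_H_dualPoint hp0 hp1 hβ hB hx.le hy.le hxy)⟩

/-- The other end of the quarter circle, reduced to the first by exchanging $x$ and $y$ and
inverting $v$ and $r$. The factors pulled out of the logarithms are the value of $H$ at the corner.
-/
lemma exists_H_gt_corner (hp0 : 0 < p) (hp1 : p < 1) (hβ : 0 < β) (hB : B ≠ 0) :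
    ∃ z ∈ rect p, H p β B ((1 - p) / 2, p) < H p β B z := by
  have hv := vRatio_pos hβ hB
  have hr := rRatio_pos hβ B
  obtain ⟨y, x, hy, hx, hxy, hpos⟩ := exists_direction_pos hp0 hp1 (inv_pos.2 hv) (inv_pos.2 hr)
  rw [add_comm] at hxy
  refine ⟨_, dualPoint_mem hp0 hp1 hv hr hx.le hy.le,
    lt_of_lt_of_le ?_ (le_H_dualPoint hp0 hp1 hβ hB hx.le hy.le hxy)⟩
  rw [H_eq, entropy_corner, ← vRatio_sq hβ, Real.log_pow]
  set v := vRatio β B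
  set r := rRatio β B
  have e1 : x + v * y = v * (y + v⁻¹ * x) := by field_simp; ring
  have e2 : x ^ 2 + r * y ^ 2 = r * (y ^ 2 + r⁻¹ * x ^ 2) := by field_simp; ring
  rw [e1, e2, Real.log_mul hv.ne' (by positivity), Real.log_mul hr.ne' (by positivity)]
  push_cast
  linarith

/-- Passing from $z$ to its direction and on to the dual point does not decrease $H$, so by
uniqueness $z$ is that dual point. It is interior unless $x$ or $y$ is zero, which would make $z$
one of two corners where $H$ is not maximal. -/
lemma mem_interior_of_isMax (hp0 : 0 < p) (hp1 : p < 1) (hβ : 0 < β) (hB : B ≠ 0) {z : ℝ × ℝ}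
    (hz : z ∈ rect p) (hmax : ∀ w ∈ rect p, H p β B w ≤ H p β B z) :
    z ∈ interior (rect p) := by
  have hv := vRatio_pos hβ hB
  have hr := rRatio_pos hβ B
  obtain ⟨x, y, hx, hy, hxy, hx2, hy2, hle⟩ := exists_H_le hp0 hp1 hβ hB hz
  have hk : (1 + p) / 2 ≠ 0 := by linarith
  have hz' := mem_rect.1 hz
  have hx0 : x ≠ 0 := by
    rintro rfl
    obtain ⟨w, hw, hlt⟩ := exists_H_gt_corner hp0 hp1 hβ hB
    have h1 : z.1 + z.2 = (1 + p) / 2 := by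
      rw [eq_comm, zero_pow two_ne_zero, sub_eq_zero, eq_comm, div_eq_one_iff_eq hk] at hx2
      exact hx2
    have h2 : z = ((1 - p) / 2, p) := Prod.ext (by simp only; linarith) (by simp only; linarith)
    rw [← h2] at hlt
    exact absurd (hmax w hw) (not_le.2 hlt)
  have hy0 : y ≠ 0 := by
    rintro rfl
    obtain ⟨w, hw, hlt⟩ := exists_H_pos hp0 hp1 hβ hB
    have h1 : z.1 + z.2 = 0 := by
      rw [eq_comm, zero_pow two_ne_zero, div_eq_zero_iff, or_iff_left hk] at hy2
      exact hy2
    have h2 : z = (0, 0) := Prod.ext (by simp only; linarith) (by simp only; linarith)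
    rw [← H_zero p β B, ← h2] at hlt
    exact absurd (hmax w hw) (not_le.2 hlt)
  have hx' := lt_of_le_of_ne hx hx0.symm
  have hy' := lt_of_le_of_ne hy hy0.symm
  have hge := hle.trans (le_H_dualPoint hp0 hp1 hβ hB hx hy hxy)
  have heq : z = dualPoint p (vRatio β B) (rRatio β B) x y := by
    refine (strictConcaveOn_H hp1 β B).eq_of_isMaxOn hmax (fun w hw => ?_) hz
      (dualPoint_mem hp0 hp1 hv hr hx hy)
    exact (hmax w hw).trans hge
  rw [heq]
  exact dualPoint_mem_interior hp0 hp1 hv hr hx' hy'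

lemma HExt_of_ne (hβ : 0 < β) (hB : B ≠ 0) (z : ℝ × ℝ) : HExt p β B z = H p β B z := by
  rw [HExt, if_neg]
  exact fun h => (aRatio_pos hβ hB).ne' h.1

/-- Only the segment $s=0$ matters. There the entropy is at most zero by superadditivity, and $t\log
r<0$. -/
lemma HExt_lt_zero (hp1 : p < 1) (hβ : 0 < β) {w : ℝ × ℝ} (hw : w ∈ rect p)
    (hne : w ≠ (0, 0)) : HExt p β 0 w < HExt p β 0 (0, 0) := by
  have h0 : HExt p β 0 (0, 0) = ((0 : ℝ) : EReal) := by
    rw [HExt, if_neg (by simp), H_zero]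
  have ha := (aRatio_eq_zero_iff hβ 0).2 rfl
  obtain ⟨⟨hs0, hs1⟩, ht0, ht1⟩ := mem_rect.1 hw
  rw [h0, HExt]
  split_ifs with h
  · exact EReal.bot_lt_coe 0
  · have hs : w.1 = 0 := le_antisymm (not_lt.1 fun h2 => h ⟨ha, h2⟩) hs0
    have ht : 0 < w.2 := lt_of_le_of_ne ht0 fun h2 => hne (Prod.ext hs h2.symm)
    rw [EReal.coe_lt_coe_iff, H_eq, entropy_eq, hs]
    have hr := Real.log_neg (rRatio_pos hβ 0) (rRatio_lt_one β 0)
    have h1 := mul_neg_of_pos_of_neg ht hr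
    have h2 := splitEntropy_superadditive le_rfl ht0 (show 0 ≤ (1 - p) / 2 by linarith)
      (sub_nonneg.2 ht1)
    rw [zero_add, add_sub_cancel] at h2
    have h3 : splitEntropy 0 w.2 = 0 := by simp [splitEntropy]
    have h4 : splitEntropy ((1 - p) / 2) p
        = Real.negMulLog ((1 - p) / 2) + Real.negMulLog p - Real.negMulLog ((1 + p) / 2) := by
      rw [splitEntropy]
      ring_nf
    rw [h3, h4] at h2
    rw [h3, sub_zero, Real.negMulLog_zero]
    linarith

lemma exists_unique_max (hp0 : 0 < p) (hp1 : p < 1) (hβ : 0 < β) (B : ℝ) :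
    ∃ z, z ∈ rect p ∧ ∀ w ∈ rect p, w ≠ z → HExt p β B w < HExt p β B z := by
  rcases eq_or_ne B 0 with rfl | hB
  · exact ⟨(0, 0), zero_mem_rect hp0 hp1, fun w hw hne => HExt_lt_zero hp1 hβ hw hne⟩
  · obtain ⟨z, hz, hmax⟩ := (isCompact_rect p).exists_isMaxOn ⟨_, zero_mem_rect hp0 hp1⟩
      (continuous_H p β B).continuousOn
    refine ⟨z, hz, fun w hw hne => ?_⟩
    rw [HExt_of_ne hβ hB, HExt_of_ne hβ hB, EReal.coe_lt_coe_iff]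
    refine lt_of_le_of_ne (hmax hw) fun heq => hne ?_
    refine (strictConcaveOn_H hp1 β B).eq_of_isMaxOn (fun w' hw' => ?_) hmax hw hz
    simp only [Set.mem_ofPred_eq, heq]
    exact hmax hw'

/-- The maximum point of `H`. -/
noncomputable def maxPoint (p β B : ℝ) : ℝ × ℝ :=
  Classical.epsilon fun z => z ∈ rect p ∧ ∀ w ∈ rect p, w ≠ z → HExt p β B w < HExt p β B z

lemma maxPoint_spec (hp0 : 0 < p) (hp1 : p < 1) (hβ : 0 < β) (B : ℝ) :
    maxPoint p β B ∈ rect p ∧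
      ∀ w ∈ rect p, w ≠ maxPoint p β B → HExt p β B w < HExt p β B (maxPoint p β B) :=
  Classical.epsilon_spec (exists_unique_max hp0 hp1 hβ B)

lemma maxPoint_zero (hp0 : 0 < p) (hp1 : p < 1) (hβ : 0 < β) : maxPoint p β 0 = (0, 0) := by
  by_contra hne
  have h1 := (maxPoint_spec hp0 hp1 hβ 0).2 _ (zero_mem_rect hp0 hp1) (Ne.symm hne)
  exact lt_asymm h1 (HExt_lt_zero hp1 hβ (maxPoint_spec hp0 hp1 hβ 0).1 hne)

lemma H_le_H_maxPoint (hp0 : 0 < p) (hp1 : p < 1) (hβ : 0 < β) (hB : B ≠ 0) {w : ℝ × ℝ}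
    (hw : w ∈ rect p) : H p β B w ≤ H p β B (maxPoint p β B) := by
  rcases eq_or_ne w (maxPoint p β B) with h | h
  · rw [h]
  · have := (maxPoint_spec hp0 hp1 hβ B).2 w hw h
    rw [HExt_of_ne hβ hB, HExt_of_ne hβ hB, EReal.coe_lt_coe_iff] at this
    exact this.le

lemma H_maxPoint_nonneg (hp0 : 0 < p) (hp1 : p < 1) (hβ : 0 < β) (B : ℝ) :
    0 ≤ H p β B (maxPoint p β B) := by
  rcases eq_or_ne B 0 with rfl | hB
  · rw [maxPoint_zero hp0 hp1 hβ, H_zero]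
  · rw [← H_zero p β B]
    exact H_le_H_maxPoint hp0 hp1 hβ hB (zero_mem_rect hp0 hp1)

/-- In the dual problem $\log(x+vy)\le\frac12\log(1+v^2)\le v^2/2$, and the second logarithm is at
most zero because $r<1$. This bound controls the pressure near zero field. -/
lemma H_maxPoint_le (hp0 : 0 < p) (hp1 : p < 1) (hβ : 0 < β) (B : ℝ) :
    H p β B (maxPoint p β B) ≤ (1 - p) / 2 * (aRatio β B * rRatio β B ^ 2) := by
  rcases eq_or_ne B 0 with rfl | hB
  · rw [maxPoint_zero hp0 hp1 hβ, H_zero, (aRatio_eq_zero_iff hβ 0).2 rfl]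
    simp
  · obtain ⟨x, y, hx, hy, hxy, -, -, hle⟩ :=
      exists_H_le hp0 hp1 hβ hB (maxPoint_spec hp0 hp1 hβ B).1
    have hv := vRatio_pos hβ hB
    have hr := rRatio_pos hβ B
    have hr1 := rRatio_lt_one β B
    refine hle.trans ?_
    rw [← vRatio_sq hβ]
    have h1 : 0 < x + vRatio β B * y := by
      rcases hx.eq_or_lt with h | h
      · have : y ≠ 0 := by rintro rfl; rw [← h] at hxy; norm_num at hxy
        have := lt_of_le_of_ne hy this.symm
        positivity
      · positivity
    have h2 : Real.log ((x + vRatio β B * y) ^ 2) ≤ vRatio β B ^ 2 := by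
      have h3 : Real.log ((x + vRatio β B * y) ^ 2) ≤ Real.log (1 + vRatio β B ^ 2) :=
        Real.log_le_log (by positivity) (by nlinarith [sq_nonneg (vRatio β B * x - y)])
      have := Real.log_le_sub_one_of_pos (show 0 < 1 + vRatio β B ^ 2 by positivity)
      linarith
    rw [Real.log_pow] at h2
    push_cast at h2
    have h4 : Real.log (x ^ 2 + rRatio β B * y ^ 2) ≤ 0 :=
      Real.log_nonpos (by positivity) (by nlinarith [sq_nonneg y])
    have h5 := mul_nonpos_of_nonneg_of_nonpos hp0.le h4
    have h6 := mul_le_mul_of_nonneg_left h2 (show 0 ≤ (1 - p) / 2 by linarith)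
    linarith

/-- The limit of the annealed pressure. -/
noncomputable def pressure (p β B : ℝ) : ℝ :=
  Real.log (lamPlus β B) + (1 - p) / 2 * Real.log (APlus β B) + H p β B (maxPoint p β B)

lemma tendsto_pressure (hp0 : 0 < p) (hp1 : p < 1) (d : (N : ℕ) → Fin N → ℕ)
    (hd : ∀ N, IsOneTwoDegrees p (d N)) (hβ : 0 < β) (B : ℝ) :
    Tendsto (fun N => annealedPressure (d N) β B) (evenSizes d) (𝓝 (pressure p β B)) := by
  have hr1 := rRatio_lt_one β B
  have hr0 := rRatio_pos hβ B
  rcases eq_or_ne B 0 with rfl | hB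
  · have hv : vRatio β 0 = 0 := by
      rw [vRatio, (aRatio_eq_zero_iff hβ 0).2 rfl, zero_mul, Real.sqrt_zero]
    rw [pressure, maxPoint_zero hp0 hp1 hβ, H_zero]
    refine tendsto_annealedPressure hp0 hp1 d hd hβ (fun x y hx hy hxy h0 => ?_)
      ⟨1, 0, by norm_num, by norm_num, by norm_num⟩
    rw [hv, zero_mul, add_zero] at h0 ⊢
    have h1 : Real.log x ≤ 0 := Real.log_nonpos hx (by nlinarith [sq_nonneg y])
    have h2 : Real.log (x ^ 2 + rRatio β 0 * y ^ 2) ≤ 0 :=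
      Real.log_nonpos (by positivity) (by nlinarith [sq_nonneg y])
    nlinarith
  · refine tendsto_annealedPressure hp0 hp1 d hd hβ (fun x y hx hy hxy h0 => ?_) ?_
    · exact (le_H_dualPoint hp0 hp1 hβ hB hx hy hxy).trans (H_le_H_maxPoint hp0 hp1 hβ hB
        (dualPoint_mem hp0 hp1 (vRatio_pos hβ hB) hr0 hx hy))
    · obtain ⟨x, y, hx, hy, hxy, -, -, hle⟩ :=
        exists_H_le hp0 hp1 hβ hB (maxPoint_spec hp0 hp1 hβ B).1
      have hv := vRatio_pos hβ hB
      refine ⟨x, y, hxy, ?_, hle⟩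
      rcases hx.eq_or_lt with h | h
      · have : y ≠ 0 := by rintro rfl; rw [← h] at hxy; norm_num at hxy
        have := lt_of_le_of_ne hy this.symm
        positivity
      · positivity

/-! ### Differentiability in the field -/

lemma differentiable_lamPlus (β : ℝ) : Differentiable ℝ (lamPlus β) := by
  intro B
  have h : Real.sinh B ^ 2 + Real.exp (-4 * β) ≠ 0 := by positivity
  unfold lamPlus
  have h2 : DifferentiableAt ℝ (fun b => √(Real.sinh b ^ 2 + Real.exp (-4 * β))) B :=
    DifferentiableAt.sqrt (by fun_prop) h
  have h3 := Real.differentiable_cosh B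
  fun_prop

lemma differentiable_lamMinus (β : ℝ) : Differentiable ℝ (lamMinus β) := by
  intro B
  have h : Real.sinh B ^ 2 + Real.exp (-4 * β) ≠ 0 := by positivity
  unfold lamMinus
  have h2 : DifferentiableAt ℝ (fun b => √(Real.sinh b ^ 2 + Real.exp (-4 * β))) B :=
    DifferentiableAt.sqrt (by fun_prop) h
  have h3 := Real.differentiable_cosh B
  fun_prop

lemma differentiable_APlus (β : ℝ) : Differentiable ℝ (APlus β) := by
  intro B
  have h := differentiable_lamPlus β B
  have h0 := lamPlus_pos β B
  unfold APlus
  exact DifferentiableAt.fun_div (by fun_prop) (by fun_prop) (by positivity)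

lemma differentiable_AMinus (hβ : 0 < β) : Differentiable ℝ (AMinus β) := by
  intro B
  have h := differentiable_lamPlus β B
  have h' := differentiable_lamMinus β B
  have h0 := lamMinus_pos hβ B
  unfold AMinus
  exact DifferentiableAt.fun_div (by fun_prop) (by fun_prop) (by positivity)

lemma differentiable_rRatio (β : ℝ) : Differentiable ℝ (rRatio β) := fun B =>
  (differentiable_lamMinus β B).fun_div (differentiable_lamPlus β B) (lamPlus_pos β B).ne'

lemma differentiable_aRatio_mul (hβ : 0 < β) :
    Differentiable ℝ fun b => aRatio β b * rRatio β b ^ 2 := fun B =>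
  ((differentiable_AMinus hβ B).fun_div (differentiable_APlus β B) (APlus_pos β B).ne').fun_mul
    ((differentiable_rRatio β B).fun_pow 2)

/-- The maximum point depends continuously on the field. -/
lemma tendsto_maxPoint (hp0 : 0 < p) (hp1 : p < 1) (hβ : 0 < β) (hB : B ≠ 0) :
    Tendsto (maxPoint p β) (𝓝 B) (𝓝 (maxPoint p β B)) := by
  have hα : ContinuousAt (fun b => Real.log (aRatio β b * rRatio β b ^ 2)) B :=
    (differentiable_aRatio_mul hβ B).continuousAt.log
      (mul_pos (aRatio_pos hβ hB) (pow_pos (rRatio_pos hβ B) 2)).ne'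
  have hρ : ContinuousAt (fun b => Real.log (rRatio β b)) B :=
    (differentiable_rRatio β B).continuousAt.log (rRatio_pos hβ B).ne'
  set α := fun b => Real.log (aRatio β b * rRatio β b ^ 2) with hαdef
  set ρ := fun b => Real.log (rRatio β b) with hρdef
  have hH : ∀ b z, H p β b z = entropy p z + z.1 * α b + z.2 * ρ b := fun b z => H_eq β b z
  have hmem : ∀ b, maxPoint p β b ∈ rect p := fun b => (maxPoint_spec hp0 hp1 hβ b).1
  -- The field enters only through the coefficients of $s$ and $t$, so $H$ is continuous in it
  -- uniformly on the rectangle.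
  have hdiff : ∀ b, ∀ z ∈ rect p,
      |H p β b z - H p β B z| ≤ (1 - p) / 2 * |α b - α B| + p * |ρ b - ρ B| := by
    intro b z hz
    obtain ⟨⟨hs0, hs1⟩, ht0, ht1⟩ := mem_rect.1 hz
    have : H p β b z - H p β B z = z.1 * (α b - α B) + z.2 * (ρ b - ρ B) := by
      rw [hH, hH]; ring
    rw [this]
    refine (abs_add_le _ _).trans ?_
    rw [abs_mul, abs_mul, abs_of_nonneg hs0, abs_of_nonneg ht0]
    gcongr
  have he : Tendsto (fun b => H p β B (maxPoint p β B)
      - 2 * ((1 - p) / 2 * |α b - α B| + p * |ρ b - ρ B|)) (𝓝 B)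
      (𝓝 (H p β B (maxPoint p β B))) := by
    have h1 : Tendsto (fun b => |α b - α B|) (𝓝 B) (𝓝 |α B - α B|) :=
      (hα.tendsto.sub_const _).abs
    have h2 : Tendsto (fun b => |ρ b - ρ B|) (𝓝 B) (𝓝 |ρ B - ρ B|) :=
      (hρ.tendsto.sub_const _).abs
    have h3 := (((h1.const_mul ((1 - p) / 2)).add (h2.const_mul p)).const_mul 2).const_sub
      (H p β B (maxPoint p β B))
    simpa using h3
  have hlow : ∀ᶠ b in 𝓝 B, H p β B (maxPoint p β B)
      - 2 * ((1 - p) / 2 * |α b - α B| + p * |ρ b - ρ B|) ≤ H p β B (maxPoint p β b) := by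
    filter_upwards [isOpen_ne.mem_nhds hB] with b hb
    have h1 := (abs_le.1 (hdiff b _ (hmem b))).2
    have h2 := (abs_le.1 (hdiff b _ (hmem B))).1
    have h3 := H_le_H_maxPoint hp0 hp1 hβ hb (hmem B)
    linarith
  -- By compactness it suffices to exclude other cluster points; $H$ would be strictly smaller
  -- there, although `hlow` and `he` keep its values near the maximum.
  refine (isCompact_rect p).tendsto_nhds_of_unique_mapClusterPt
    (Eventually.of_forall hmem) fun x hx hcl => ?_
  by_contra hne
  have hlt := (maxPoint_spec hp0 hp1 hβ B).2 x hx hne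
  rw [HExt_of_ne hβ hB, HExt_of_ne hβ hB, EReal.coe_lt_coe_iff] at hlt
  obtain ⟨c, hc1, hc2⟩ := exists_between hlt
  have h1 := hcl.frequently ((continuous_H p β B).continuousAt.eventually (gt_mem_nhds hc1))
  have h2 := (he.eventually (lt_mem_nhds hc2)).and hlow
  obtain ⟨b, hb1, hb2, hb3⟩ := (h1.and_eventually h2).exists
  linarith

/-- The envelope theorem: moving the maximum point has no first-order effect. This needs its
continuity, but not its differentiability. -/
lemma hasDerivAt_H_maxPoint_of_ne (hp0 : 0 < p) (hp1 : p < 1) (hβ : 0 < β) (hB : B ≠ 0) :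
    HasDerivAt (fun b => H p β b (maxPoint p β b))
      ((maxPoint p β B).1 * deriv (fun b => Real.log (aRatio β b * rRatio β b ^ 2)) B
        + (maxPoint p β B).2 * deriv (fun b => Real.log (rRatio β b)) B) B := by
  have hα : DifferentiableAt ℝ (fun b => Real.log (aRatio β b * rRatio β b ^ 2)) B :=
    (differentiable_aRatio_mul hβ B).log
      (mul_pos (aRatio_pos hβ hB) (pow_pos (rRatio_pos hβ B) 2)).ne'
  have hρ : DifferentiableAt ℝ (fun b => Real.log (rRatio β b)) B :=
    (differentiable_rRatio β B).log (rRatio_pos hβ B).ne'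
  set α := fun b => Real.log (aRatio β b * rRatio β b ^ 2) with hαdef
  set ρ := fun b => Real.log (rRatio β b) with hρdef
  have hH : ∀ b z, H p β b z = entropy p z + z.1 * α b + z.2 * ρ b := fun b z => H_eq β b z
  have hmem : ∀ b, maxPoint p β b ∈ rect p := fun b => (maxPoint_spec hp0 hp1 hβ b).1
  have hcont := tendsto_maxPoint hp0 hp1 hβ hB
  have hlin : HasDerivAt (fun b => H p β b (maxPoint p β B))
      ((maxPoint p β B).1 * deriv α B + (maxPoint p β B).2 * deriv ρ B) B := by
    simp only [hH]
    exact ((hα.hasDerivAt.const_mul _).const_add _).add (hρ.hasDerivAt.const_mul _)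
  have hrest : HasDerivAt (fun b => H p β b (maxPoint p β b) - H p β b (maxPoint p β B)) 0 B := by
    rw [hasDerivAt_iff_isLittleO]
    simp only [sub_self, sub_zero, smul_zero]
    -- With $z_b$ the maximum point at field $b$, maximality at both fields gives $0\le
    -- H_b(z_b)-H_b(z_B)\le(H_b-H_B)(z_b)-(H_b-H_B)(z_B)$. The entropy cancels on the right, leaving
    -- products $o(1)\cdot O(b-B)$.
    have h1 : (fun b => ((maxPoint p β b).1 - (maxPoint p β B).1) * (α b - α B)
        + ((maxPoint p β b).2 - (maxPoint p β B).2) * (ρ b - ρ B)) =o[𝓝 B] fun b => b - B := by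
      have c1 : Tendsto (fun b => (maxPoint p β b).1 - (maxPoint p β B).1) (𝓝 B) (𝓝 0) := by
        simpa using ((continuous_fst.tendsto _).comp hcont).sub_const (maxPoint p β B).1
      have c2 : Tendsto (fun b => (maxPoint p β b).2 - (maxPoint p β B).2) (𝓝 B) (𝓝 0) := by
        simpa using ((continuous_snd.tendsto _).comp hcont).sub_const (maxPoint p β B).2
      have d1 := ((Asymptotics.isLittleO_one_iff ℝ).2 c1).mul_isBigO hα.isBigO_sub
      have d2 := ((Asymptotics.isLittleO_one_iff ℝ).2 c2).mul_isBigO hρ.isBigO_sub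
      simp only [one_mul] at d1 d2
      exact d1.add d2
    refine Asymptotics.IsBigO.trans_isLittleO (Asymptotics.IsBigO.of_bound 1 ?_) h1
    filter_upwards [isOpen_ne.mem_nhds hB] with b hb
    have h2 := H_le_H_maxPoint hp0 hp1 hβ hb (hmem B)
    have h3 := H_le_H_maxPoint hp0 hp1 hβ hB (hmem b)
    rw [one_mul, Real.norm_eq_abs, Real.norm_eq_abs, abs_of_nonneg (by linarith)]
    refine le_trans ?_ (le_abs_self _)
    simp only [hH] at h3 ⊢
    linarith
  have := hlin.fun_add hrest
  simpa using this

/-- At zero field $\log(ar^2)$ is not available. Instead the maximum lies between $0$ and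
$\frac{1-p}2ar^2$, and $ar^2$ is differentiable with its minimum $0$ at $B=0$. -/
lemma hasDerivAt_H_maxPoint_zero (hp0 : 0 < p) (hp1 : p < 1) (hβ : 0 < β) :
    HasDerivAt (fun b => H p β b (maxPoint p β b)) 0 0 := by
  have hg := differentiable_aRatio_mul hβ 0
  have hnn : ∀ b, 0 ≤ aRatio β b * rRatio β b ^ 2 := fun b =>
    mul_nonneg (aRatio_nonneg hβ b) (sq_nonneg _)
  have h0 : aRatio β 0 * rRatio β 0 ^ 2 = 0 := by
    rw [(aRatio_eq_zero_iff hβ 0).2 rfl, zero_mul]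
  have hd0 : deriv (fun b => aRatio β b * rRatio β b ^ 2) 0 = 0 := by
    refine IsLocalMin.deriv_eq_zero (Eventually.of_forall fun b => ?_)
    simp only [h0]
    exact hnn b
  have h1 := hg.hasDerivAt
  rw [hd0, hasDerivAt_iff_isLittleO] at h1
  rw [hasDerivAt_iff_isLittleO]
  simp only [h0, sub_zero, smul_zero] at h1 ⊢
  refine Asymptotics.IsBigO.trans_isLittleO (Asymptotics.IsBigO.of_bound ((1 - p) / 2)
    (Eventually.of_forall fun b => ?_)) h1
  rw [maxPoint_zero hp0 hp1 hβ, H_zero, sub_zero, Real.norm_of_nonneg (hnn b),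
    Real.norm_of_nonneg (H_maxPoint_nonneg hp0 hp1 hβ b)]
  exact H_maxPoint_le hp0 hp1 hβ b

/-- The derivative of the limiting pressure in the field. -/
lemma hasDerivAt_pressure (hp0 : 0 < p) (hp1 : p < 1) (hβ : 0 < β) (B : ℝ) :
    HasDerivAt (pressure p β)
      (deriv (fun b => Real.log (lamPlus β b)) B
        + (1 - p) / 2 * deriv (fun b => Real.log (APlus β b)) B
        + (maxPoint p β B).1 * deriv (fun b => Real.log (aRatio β b * rRatio β b ^ 2)) B
        + (maxPoint p β B).2 * deriv (fun b => Real.log (rRatio β b)) B) B := by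
  have h1 := ((differentiable_lamPlus β B).log (lamPlus_pos β B).ne').hasDerivAt
  have h2 := ((differentiable_APlus β B).log (APlus_pos β B).ne').hasDerivAt
  have h3 : HasDerivAt (fun b => H p β b (maxPoint p β b))
      ((maxPoint p β B).1 * deriv (fun b => Real.log (aRatio β b * rRatio β b ^ 2)) B
        + (maxPoint p β B).2 * deriv (fun b => Real.log (rRatio β b)) B) B := by
    -- At zero field both coordinates of the maximum point vanish, so the value of `deriv` for
    -- $\log(ar^2)$ is irrelevant.
    rcases eq_or_ne B 0 with rfl | hB
    · have := hasDerivAt_H_maxPoint_zero hp0 hp1 hβ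
      rw [maxPoint_zero hp0 hp1 hβ]
      simpa using this
    · exact hasDerivAt_H_maxPoint_of_ne hp0 hp1 hβ hB
  have := (h1.add (h2.const_mul ((1 - p) / 2))).add h3
  rw [← add_assoc] at this
  exact this

end MaxPoint

/-! ### Convexity of the pressure and convergence of the magnetization -/

/-- Divide the summands at $x$ and at $y$ by their sums and apply convexity of the exponential
termwise: the resulting weights add up to one. -/
lemma convexOn_log_sum_exp {ι : Type*} [Fintype ι] [Nonempty ι] {a : ι → ℝ} (ha : ∀ i, 0 < a i)
    (S : ι → ℝ) : ConvexOn ℝ Set.univ fun b : ℝ => Real.log (∑ i, a i * Real.exp (b * S i)) := by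
  have hpos : ∀ b : ℝ, 0 < ∑ i, a i * Real.exp (b * S i) := fun b =>
    Finset.sum_pos (fun i _ => mul_pos (ha i) (Real.exp_pos _)) Finset.univ_nonempty
  refine ⟨convex_univ, fun x _ y _ s t hs ht hst => ?_⟩
  simp only [smul_eq_mul]
  have hexp : ∀ b, Real.exp (Real.log (∑ i, a i * Real.exp (b * S i)))
      = ∑ i, a i * Real.exp (b * S i) := fun b => Real.exp_log (hpos b)
  set X := Real.log (∑ i, a i * Real.exp (x * S i)) with hX
  set Y := Real.log (∑ i, a i * Real.exp (y * S i)) with hY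
  have key : ∑ i, a i * Real.exp (s * (x * S i - X) + t * (y * S i - Y)) ≤ 1 := by
    calc _ ≤ ∑ i, a i * (s * Real.exp (x * S i - X) + t * Real.exp (y * S i - Y)) := by
          refine Finset.sum_le_sum fun i _ => mul_le_mul_of_nonneg_left ?_ (ha i).le
          exact convexOn_exp.2 (Set.mem_univ _) (Set.mem_univ _) hs ht hst
      _ = s * ((∑ i, a i * Real.exp (x * S i)) / Real.exp X)
          + t * ((∑ i, a i * Real.exp (y * S i)) / Real.exp Y) := by
          rw [Finset.sum_div, Finset.sum_div, Finset.mul_sum, Finset.mul_sum,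
            ← Finset.sum_add_distrib]
          refine Finset.sum_congr rfl fun i _ => ?_
          rw [Real.exp_sub, Real.exp_sub]
          ring
      _ = 1 := by
          rw [hX, hY, hexp, hexp, div_self (hpos x).ne', div_self (hpos y).ne']
          linarith
  have hle : ∑ i, a i * Real.exp ((s * x + t * y) * S i) ≤ Real.exp (s * X + t * Y) := by
    have : ∑ i, a i * Real.exp (s * (x * S i - X) + t * (y * S i - Y))
        = (∑ i, a i * Real.exp ((s * x + t * y) * S i)) / Real.exp (s * X + t * Y) := by
      rw [Finset.sum_div]
      refine Finset.sum_congr rfl fun i _ => ?_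
      rw [mul_div_assoc, ← Real.exp_sub]
      ring_nf
    rw [this, div_le_one (Real.exp_pos _)] at key
    exact key
  exact (Real.log_le_iff_le_exp (hpos _)).2 hle

lemma hasDerivAt_log_sum_exp {ι : Type*} [Fintype ι] [Nonempty ι] {a : ι → ℝ} (ha : ∀ i, 0 < a i)
    (S : ι → ℝ) (B : ℝ) :
    HasDerivAt (fun b : ℝ => Real.log (∑ i, a i * Real.exp (b * S i)))
      ((∑ i, a i * Real.exp (B * S i) * S i) / ∑ i, a i * Real.exp (B * S i)) B := by
  have hpos : 0 < ∑ i, a i * Real.exp (B * S i) :=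
    Finset.sum_pos (fun i _ => mul_pos (ha i) (Real.exp_pos _)) Finset.univ_nonempty
  refine HasDerivAt.log ?_ hpos.ne'
  refine HasDerivAt.fun_sum fun i _ => ?_
  have h := (((hasDerivAt_id B).mul_const (S i)).exp).const_mul (a i)
  simp only [id_eq, one_mul] at h
  rw [mul_assoc]
  exact h

/-- Derivatives of convex functions converge when the functions converge pointwise to a function that
is differentiable at the point. -/
lemma tendsto_deriv_of_convexOn {ι : Type*} {l : Filter ι} {f : ι → ℝ → ℝ} {g : ℝ → ℝ} {B m : ℝ}
    {f' : ι → ℝ} (hconv : ∀ᶠ n in l, ConvexOn ℝ Set.univ (f n))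
    (hderiv : ∀ᶠ n in l, HasDerivAt (f n) (f' n) B)
    (hlim : ∀ b, Tendsto (fun n => f n b) l (𝓝 (g b))) (hg : HasDerivAt g m B) :
    Tendsto f' l (𝓝 m) := by
  have hslope : ∀ y, Tendsto (fun n => slope (f n) B y) l (𝓝 (slope g B y)) := fun y => by
    simp only [slope_def_field]
    exact ((hlim y).sub (hlim B)).div_const _
  -- Fix $y$ near $B$ with a slope of the limit close to $m$; by convexity the slopes of `f n` over
  -- the same interval bound `f' n` on one side.
  have hs := hasDerivAt_iff_tendsto_slope.1 hg
  rw [tendsto_order]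
  constructor
  · intro c hc
    have hs1 : Tendsto (slope g B) (𝓝[<] B) (𝓝 m) :=
      hs.mono_left (nhdsWithin_mono _ fun y hy => ne_of_lt hy)
    obtain ⟨y, hy1, hy2⟩ := ((hs1.eventually (lt_mem_nhds hc)).and self_mem_nhdsWithin).exists
    filter_upwards [hconv, hderiv, (hslope y).eventually (lt_mem_nhds hy1)] with n h1 h2 h3
    refine h3.trans_le ?_
    rw [slope_comm]
    exact h1.slope_le_of_hasDerivAt (Set.mem_univ _) (Set.mem_univ _) hy2 h2
  · intro c hc
    have hs1 : Tendsto (slope g B) (𝓝[>] B) (𝓝 m) :=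
      hs.mono_left (nhdsWithin_mono _ fun y hy => ne_of_gt hy)
    obtain ⟨y, hy1, hy2⟩ := ((hs1.eventually (gt_mem_nhds hc)).and self_mem_nhdsWithin).exists
    filter_upwards [hconv, hderiv, (hslope y).eventually (gt_mem_nhds hy1)] with n h1 h2 h3
    exact (h1.le_slope_of_hasDerivAt (Set.mem_univ _) (Set.mem_univ _) hy2 h2).trans_lt h3

/-! ### The finite-volume pressure as the logarithm of a sum of exponentials in the field -/

section FiniteVolume

variable {N : ℕ} {d : Fin N → ℕ}

lemma cmExpect_boltzmannWeight (β B : ℝ) (σ : Fin N → ℤˣ) :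
    cmExpect d (fun π => boltzmannWeight β B π σ)
      = cmExpect d (fun π => Real.exp (β * edgeSum π σ)) * Real.exp (B * totalSpin σ) := by
  simp only [cmExpect, boltzmannWeight, Real.exp_add]
  rw [← Finset.sum_mul]
  ring

lemma cmExpect_partitionFunction_eq_sum (β B : ℝ) :
    cmExpect d (partitionFunction β B)
      = ∑ σ : Fin N → ℤˣ,
        cmExpect d (fun π => Real.exp (β * edgeSum π σ)) * Real.exp (B * totalSpin σ) := by
  simp only [← cmExpect_boltzmannWeight]
  simp only [cmExpect, partitionFunction]
  rw [← Finset.sum_div, Finset.sum_comm]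

lemma cmExpect_exp_pos (hev : Even (∑ i, d i)) (β : ℝ) (σ : Fin N → ℤˣ) :
    0 < cmExpect d (fun π => Real.exp (β * edgeSum π σ)) := by
  obtain ⟨m, hm⟩ := hev
  have hcard : (0 : ℝ) < Fintype.card (Pairing d) :=
    card_matching_pos (m := m) (by rw [card_halfEdge, hm]; ring)
  have : Nonempty (Pairing d) := Fintype.card_pos_iff.1 (by exact_mod_cast hcard)
  exact div_pos (Finset.sum_pos (fun _ _ => Real.exp_pos _) Finset.univ_nonempty) hcard

lemma convexOn_annealedPressure (hev : Even (∑ i, d i)) (β : ℝ) :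
    ConvexOn ℝ Set.univ (annealedPressure d β) := by
  have h := (convexOn_log_sum_exp (cmExpect_exp_pos hev β) totalSpin).smul
    (show 0 ≤ 1 / (N : ℝ) by positivity)
  simp only [← cmExpect_partitionFunction_eq_sum, smul_eq_mul] at h
  exact h

lemma hasDerivAt_annealedPressure (hev : Even (∑ i, d i)) (β B : ℝ) :
    HasDerivAt (annealedPressure d β) (annealedMagnetization d β B) B := by
  have h := (hasDerivAt_log_sum_exp (cmExpect_exp_pos hev β) totalSpin B).const_mul (1 / (N : ℝ))
  simp only [← cmExpect_partitionFunction_eq_sum] at h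
  refine h.congr_deriv ?_
  simp only [annealedMagnetization, annealedMeasure, cmExpect_boltzmannWeight]
  rw [Finset.sum_div, Finset.mul_sum]
  refine Finset.sum_congr rfl fun σ _ => ?_
  ring

lemma annealedPressure_neg (d : Fin N → ℕ) (β B : ℝ) :
    annealedPressure d β (-B) = annealedPressure d β B := by
  have h : partitionFunction (d := d) β (-B) = partitionFunction β B := by
    funext π
    refine Fintype.sum_equiv (Equiv.neg _) _ _ fun σ => ?_
    simp [boltzmannWeight, edgeSum, totalSpin, spin]
  rw [annealedPressure, annealedPressure, h]

end FiniteVolume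

/-- If $N+\lfloor pN\rfloor$ were odd for all large $N$, the floor would increase by at least one at
every step, contradicting $p<1$. Nontriviality of the filter is what lets convexity and evenness
pass to the limit. -/
lemma evenSizes_neBot {p : ℝ} (hp0 : 0 < p) (hp1 : p < 1) (d : (N : ℕ) → Fin N → ℕ)
    (hd : ∀ N, IsOneTwoDegrees p (d N)) : (evenSizes d).NeBot := by
  have hsum : ∀ N, 0 < N → ∑ i, d N i = N + ⌊p * (N : ℝ)⌋₊ := fun N hN => by
    have h1 := sum_degrees (d N) (hd N).1 (card_degree_one (hd N)) (hd N).2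
    have h2 := natFloor_mul_lt hp0 hp1 hN
    omega
  rw [evenSizes, ← frequently_mem_iff_neBot]
  by_contra hcon
  rw [not_frequently] at hcon
  obtain ⟨K, hK⟩ := eventually_atTop.1 (hcon.and (eventually_gt_atTop 0))
  have hodd : ∀ N, K ≤ N → Odd (N + ⌊p * (N : ℝ)⌋₊) := fun N hN => by
    obtain ⟨h1, h2⟩ := hK N hN
    rw [← hsum N h2]
    exact Nat.not_even_iff_odd.1 h1
  have hstep : ∀ n, ⌊p * (K : ℝ)⌋₊ + n ≤ ⌊p * ((K + n : ℕ) : ℝ)⌋₊ := by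
    intro n
    induction n with
    | zero => simp
    | succ n ih =>
      have h1 := Nat.odd_iff.1 (hodd (K + n) (by omega))
      have h2 := Nat.odd_iff.1 (hodd (K + (n + 1)) (by omega))
      have h3 : ⌊p * ((K + n : ℕ) : ℝ)⌋₊ ≤ ⌊p * ((K + (n + 1) : ℕ) : ℝ)⌋₊ := by
        gcongr
        omega
      omega
  obtain ⟨n, hn⟩ := exists_nat_gt (p * K / (1 - p))
  have h1 : ((⌊p * (K : ℝ)⌋₊ + n : ℕ) : ℝ) ≤ p * ((K + n : ℕ) : ℝ) :=
    (Nat.cast_le.2 (hstep n)).trans (Nat.floor_le (by positivity))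
  rw [div_lt_iff₀ (by linarith)] at hn
  push_cast at h1
  have h2 : (0 : ℝ) ≤ ⌊p * (K : ℝ)⌋₊ := by positivity
  linarith

/-- The derivative of an even differentiable convex function vanishes at `0+`. -/
lemma tendsto_deriv_zero_of_even_convexOn {f m : ℝ → ℝ} (hconv : ConvexOn ℝ Set.univ f)
    (heven : ∀ b, f (-b) = f b) (hf : ∀ b, HasDerivAt f (m b) b) :
    Tendsto m (𝓝[>] 0) (𝓝 0) := by
  have hm0 : m 0 = 0 := by
    have h1 := hf 0
    have h2 : HasDerivAt (fun b => f (-b)) (-m 0) 0 := by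
      have h3 := hf (-0)
      rw [neg_zero] at h3
      have := HasDerivAt.comp (0 : ℝ) (h₂ := f) (h := fun b => -b) (by simpa using h3)
        (hasDerivAt_neg (0 : ℝ))
      simpa [Function.comp_def] using this
    simp only [heven] at h2
    have := h1.unique h2
    linarith
  have hs : Tendsto (slope f 0) (𝓝[>] 0) (𝓝 0) := by
    have h := hasDerivAt_iff_tendsto_slope.1 (hf 0)
    rw [hm0] at h
    exact h.mono_left (nhdsWithin_mono _ fun y hy => ne_of_gt hy)
  have hdouble : Tendsto (fun b : ℝ => 2 * b) (𝓝[>] 0) (𝓝[>] 0) := by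
    refine tendsto_nhdsWithin_iff.2 ⟨?_, ?_⟩
    · have : Tendsto (fun b : ℝ => 2 * b) (𝓝 0) (𝓝 (2 * 0)) :=
        (continuous_const.mul continuous_id).tendsto 0
      rw [mul_zero] at this
      exact this.mono_left nhdsWithin_le_nhds
    · filter_upwards [self_mem_nhdsWithin] with b hb
      have : (0 : ℝ) < b := hb
      exact Set.mem_Ioi.2 (by linarith)
  -- This is the slope between $b$ and $2b$; by convexity `m b` lies between `m 0 = 0` and it.
  have hupper : Tendsto (fun b => 2 * slope f 0 (2 * b) - slope f 0 b) (𝓝[>] 0) (𝓝 0) := by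
    have := ((hs.comp hdouble).const_mul 2).sub hs
    simpa using this
  refine tendsto_of_tendsto_of_tendsto_of_le_of_le' tendsto_const_nhds hupper ?_ ?_
  · filter_upwards [self_mem_nhdsWithin] with b hb
    have h1 := hconv.le_slope_of_hasDerivAt (Set.mem_univ 0) (Set.mem_univ b) hb (hf 0)
    have h2 := hconv.slope_le_of_hasDerivAt (Set.mem_univ 0) (Set.mem_univ b) hb (hf b)
    linarith
  · filter_upwards [self_mem_nhdsWithin] with b hb
    have hb0 : (0 : ℝ) < b := hb
    have h1 := hconv.le_slope_of_hasDerivAt (Set.mem_univ b) (Set.mem_univ (2 * b))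
      (by linarith) (hf b)
    refine h1.trans (le_of_eq ?_)
    simp only [slope_def_field, sub_zero]
    rw [show 2 * b - b = b by ring]
    field_simp
    ring

lemma convexOn_pressure {p β : ℝ} (hp0 : 0 < p) (hp1 : p < 1) (d : (N : ℕ) → Fin N → ℕ)
    (hd : ∀ N, IsOneTwoDegrees p (d N)) (hβ : 0 < β) :
    ConvexOn ℝ Set.univ (pressure p β) := by
  have := evenSizes_neBot hp0 hp1 d hd
  refine ⟨convex_univ, fun x _ y _ s t hs ht hst => ?_⟩
  have hlim := tendsto_pressure hp0 hp1 d hd hβ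
  refine le_of_tendsto_of_tendsto (hlim _) (((hlim x).const_smul s).add ((hlim y).const_smul t)) ?_
  filter_upwards [mem_inf_of_right (mem_principal_self _)] with N hN
  exact (convexOn_annealedPressure hN β).2 (Set.mem_univ _) (Set.mem_univ _) hs ht hst

lemma pressure_neg {p β : ℝ} (hp0 : 0 < p) (hp1 : p < 1) (d : (N : ℕ) → Fin N → ℕ)
    (hd : ∀ N, IsOneTwoDegrees p (d N)) (hβ : 0 < β) (B : ℝ) :
    pressure p β (-B) = pressure p β B := by
  have := evenSizes_neBot hp0 hp1 d hd
  have h := tendsto_pressure hp0 hp1 d hd hβ (-B)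
  simp only [annealedPressure_neg] at h
  exact tendsto_nhds_unique h (tendsto_pressure hp0 hp1 d hd hβ B)

end AnnealedIsing

theorem mainTheorem5 (p : ℝ) (hp0 : 0 < p) (hp1 : p < 1)
    (d : (N : ℕ) → Fin N → ℕ) (hd : ∀ N, AnnealedIsing.IsOneTwoDegrees p (d N)) :
    ∃ s t ψ M : ℝ → ℝ → ℝ,
      (∀ β B : ℝ, 0 < β →
        -- `(s, t)` is the unique maximum point of `H` on the rectangle
        ((s β B, t β B) ∈ AnnealedIsing.rect p ∧
          ∀ z ∈ AnnealedIsing.rect p, z ≠ (s β B, t β B) →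
            AnnealedIsing.HExt p β B z < AnnealedIsing.HExt p β B (s β B, t β B)) ∧
        -- the annealed pressure
        Tendsto (fun N => AnnealedIsing.annealedPressure (d N) β B)
          (AnnealedIsing.evenSizes d) (𝓝 (ψ β B)) ∧
        ψ β B = Real.log (AnnealedIsing.lamPlus β B)
          + (1 - p) / 2 * Real.log (AnnealedIsing.APlus β B)
          + AnnealedIsing.H p β B (s β B, t β B) ∧
        -- the annealed magnetization
        Tendsto (fun N => AnnealedIsing.annealedMagnetization (d N) β B)
          (AnnealedIsing.evenSizes d) (𝓝 (M β B)) ∧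
        HasDerivAt (ψ β) (M β B) B ∧
        DifferentiableAt ℝ (fun b => Real.log (AnnealedIsing.lamPlus β b)) B ∧
        DifferentiableAt ℝ (fun b => Real.log (AnnealedIsing.APlus β b)) B ∧
        DifferentiableAt ℝ (fun b => Real.log (AnnealedIsing.rRatio β b)) B ∧
        M β B = deriv (fun b => Real.log (AnnealedIsing.lamPlus β b)) B
          + (1 - p) / 2 * deriv (fun b => Real.log (AnnealedIsing.APlus β b)) B
          + s β B * deriv (fun b =>
              Real.log (AnnealedIsing.aRatio β b * AnnealedIsing.rRatio β b ^ 2)) B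
          + t β B * deriv (fun b => Real.log (AnnealedIsing.rRatio β b)) B ∧
        -- nonzero field
        (B ≠ 0 →
          0 < AnnealedIsing.aRatio β B ∧
          StrictConcaveOn ℝ (AnnealedIsing.rect p) (AnnealedIsing.H p β B) ∧
          (s β B, t β B) ∈ interior (AnnealedIsing.rect p) ∧
          DifferentiableAt ℝ (fun b =>
            Real.log (AnnealedIsing.aRatio β b * AnnealedIsing.rRatio β b ^ 2)) B) ∧
        -- zero field
        (B = 0 → AnnealedIsing.aRatio β B = 0 ∧ s β B = 0 ∧ t β B = 0)) ∧
      -- absence of a phase transition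
      (∀ β : ℝ, 0 < β → Tendsto (M β) (𝓝[>] 0) (𝓝 0)) ∧
      AnnealedIsing.criticalInverseTemperature M = ⊤ := by
  have hM0 : ∀ β : ℝ, 0 < β → Tendsto (fun B =>
      deriv (fun b => Real.log (AnnealedIsing.lamPlus β b)) B
      + (1 - p) / 2 * deriv (fun b => Real.log (AnnealedIsing.APlus β b)) B
      + (AnnealedIsing.maxPoint p β B).1 * deriv (fun b =>
          Real.log (AnnealedIsing.aRatio β b * AnnealedIsing.rRatio β b ^ 2)) B
      + (AnnealedIsing.maxPoint p β B).2 * deriv (fun b => Real.log (AnnealedIsing.rRatio β b)) B)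
      (𝓝[>] 0) (𝓝 0) := fun β hβ =>
    AnnealedIsing.tendsto_deriv_zero_of_even_convexOn
      (AnnealedIsing.convexOn_pressure hp0 hp1 d hd hβ)
      (AnnealedIsing.pressure_neg hp0 hp1 d hd hβ)
      fun b => AnnealedIsing.hasDerivAt_pressure hp0 hp1 hβ b
  refine ⟨fun β B => (AnnealedIsing.maxPoint p β B).1, fun β B => (AnnealedIsing.maxPoint p β B).2,
    AnnealedIsing.pressure p,
    fun β B => deriv (fun b => Real.log (AnnealedIsing.lamPlus β b)) B
      + (1 - p) / 2 * deriv (fun b => Real.log (AnnealedIsing.APlus β b)) B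
      + (AnnealedIsing.maxPoint p β B).1 * deriv (fun b =>
          Real.log (AnnealedIsing.aRatio β b * AnnealedIsing.rRatio β b ^ 2)) B
      + (AnnealedIsing.maxPoint p β B).2 * deriv (fun b => Real.log (AnnealedIsing.rRatio β b)) B,
    ?_, ?_, ?_⟩
  · intro β B hβ
    have hspec := AnnealedIsing.maxPoint_spec hp0 hp1 hβ B
    have hderiv := AnnealedIsing.hasDerivAt_pressure hp0 hp1 hβ B
    have hlim := AnnealedIsing.tendsto_pressure hp0 hp1 d hd hβ
    have hev : ∀ᶠ N in AnnealedIsing.evenSizes d, Even (∑ i, d N i) :=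
      mem_inf_of_right (mem_principal_self _)
    refine ⟨hspec, hlim B, rfl, ?_, hderiv, ?_, ?_, ?_, rfl, ?_, ?_⟩
    · exact AnnealedIsing.tendsto_deriv_of_convexOn
        (hev.mono fun N hN => AnnealedIsing.convexOn_annealedPressure hN β)
        (hev.mono fun N hN => AnnealedIsing.hasDerivAt_annealedPressure hN β B) hlim hderiv
    · exact (AnnealedIsing.differentiable_lamPlus β B).log (AnnealedIsing.lamPlus_pos β B).ne'
    · exact (AnnealedIsing.differentiable_APlus β B).log (AnnealedIsing.APlus_pos β B).ne'
    · exact (AnnealedIsing.differentiable_rRatio β B).log (AnnealedIsing.rRatio_pos hβ B).ne'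
    · intro hB
      refine ⟨AnnealedIsing.aRatio_pos hβ hB, AnnealedIsing.strictConcaveOn_H hp1 β B,
        AnnealedIsing.mem_interior_of_isMax hp0 hp1 hβ hB hspec.1 fun w hw =>
          AnnealedIsing.H_le_H_maxPoint hp0 hp1 hβ hB hw, ?_⟩
      exact (AnnealedIsing.differentiable_aRatio_mul hβ B).log
        (mul_pos (AnnealedIsing.aRatio_pos hβ hB) (pow_pos (AnnealedIsing.rRatio_pos hβ B) 2)).ne'
    · rintro rfl
      have hz := AnnealedIsing.maxPoint_zero hp0 hp1 hβ
      exact ⟨(AnnealedIsing.aRatio_eq_zero_iff hβ 0).2 rfl, congrArg Prod.fst hz, congrArg Prod.snd hz⟩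
  · intro β hβ
    exact hM0 β hβ
  · rw [AnnealedIsing.criticalInverseTemperature, sInf_eq_top]
    -- A positive limit at $0^+$ contradicts uniqueness of limits, so the infimum is over the empty
    -- set.
    rintro _ ⟨β, ⟨hβ, m, hm, hlim⟩, rfl⟩
    exact absurd (tendsto_nhds_unique hlim (hM0 β hβ)) hm.ne'
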